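/- **Conventions.** A difference field is a field with an automorphism $\sigma$. Let $k_0\subseteq K\subseteq\Omega$ be difference fields, with $k_0$ algebraically closed, $K$ existentially closed (every finite system of difference equations over $K$ that is solvable in a difference field extension of $K$ is solvable in $K$) and sufficiently saturated (it is enough that $K$ is $|k_0|^+$-saturated), and $\Omega$ existentially closed and $|K|^+$-saturated. For a tuple $a$ of $\Omega$, $k_0(a)_\sigma$ is the field generated over $k_0$ by all $\sigma^i(a)$, $i\in\mathbb Z$; $qftp(a/k_0)$ is the quantifier-free type of $a$ over $k_0$, whose realisations are the tuples of $\Omega$ satisfying the same difference equations over $k_0$ as $a$; and, for $m\ge1$, $qftp(a/k_0)[m]$ is the quantifier-free type of $a$ over $k_0$ in the difference field $\Omega[m]=(\Omega,\sigma^m)$. A quantifier-free type $q$ over $k_0$ *satisfies (ALG$m$)* if $\sigma^m(a)\in k_0(a)^{\rm alg}$ for every realisation $a$ of $q$. It is *basic* if it satisfies (ALG$m$) for some $m\ge1$ and its eventual SU-rank $\lim_{m\to\infty}\mathrm{SU}(q[m!])$ is $1$. Here the SU-rank of $q[m!]$ is computed in $\Omega[m!]$ with parameter sets of size at most $|K|$,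 where $A$ is independent from $B$ over $C$ if $\mathrm{acl}(AC)$ and $\mathrm{acl}(BC)$ are algebraically independent over $\mathrm{acl}(C)$, $\mathrm{acl}(X)$ being the field-theoretic algebraic closure of the difference field generated by $X$ in $\Omega[m!]$. The type $q$ is *semi-basic* if for every realisation $a$ of $q$ there are $r\ge1$ and tuples $a_1,\dots,a_r\in k_0(a)^{\rm alg}$ which realise basic types over $k_0$, are algebraically independent (from each other) over $k_0$, and satisfy $a\in k_0(a_1,\dots,a_r)^{\rm alg}$. Let $q_1,\dots,q_N$ be quantifier-free types over $k_0$, realised by tuples $x_1,\dots,x_N$ of $\Omega$. The associated pair of coordinate rings $(R,R_\sigma)$ is $$R=\bigotimes_{i=1}^N{}_{K}\,\bigl(K\otimes_{k_0}k_0(x_i)\bigr)\ \subseteq\ R_\sigma=\bigotimes_{i=1}^N{}_{K}\,\bigl(K\otimes_{k_0}k_0(x_i)_\sigma\bigr).$$ **Proposition 2.17.** Let $(R,R_\sigma)$ be the pair of coordinate rings associated to semi-basic types $q_1,\dots,q_N$ over $k_0$, all satisfying (ALG$1$). Let $Q$ be a prime ideal of $R_\sigma$ and let $P$ be a prime ideal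 of $R$ with $P\subseteq Q\cap R$. Then there are only finitely many prime ideals $P'$ of $R_\sigma$ with $P'\cap R=P$ and $P'\subseteq Q$. Moreover, let $A$ be the integral closure of $R/P$ in its field of fractions. Then the cardinalities of the fibres of $\operatorname{Spec}A\to\operatorname{Spec}R/P$ are bounded by some natural number, and whenever $g$ is a natural number such that all these fibres have at most $g$ elements, the number of such $P'$ is at most $g$. -/

import Mathlib

open scoped TensorProduct

universe u

namespace VirtualDifference

noncomputable section

/-! ### Difference fields

All difference fields are inversive, so they are given by a field together with an automorphism. -/

/-- `(F, τ)` is a difference field extension of `(E, σ)`. -/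
def Extends {E F : Type*} [Field E] [Field F] [Algebra E F] (σ : RingAut E) (τ : RingAut F) : Prop :=
  ∀ x : E, algebraMap E F (σ x) = τ (algebraMap E F x)

/-- Evaluation of (inversive) difference polynomials over `E` at a tuple `a` of the difference field
`(F, τ)`. The variable indexed by `(j, i)` stands for the `i`-th transform of the `j`-th coordinate,
`i` any integer. -/
def diffEval (E : Type*) {F : Type*} [Field E] [Field F] [Algebra E F] (τ : RingAut F) {n : ℕ}
    (a : Fin n → F) : MvPolynomial (Fin n × ℤ) E →ₐ[E] F :=
  MvPolynomial.aeval fun p => (τ ^ p.2) (a p.1)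

/-- `(K, σ)` is existentially closed: every finite system of difference equations over `K` which has
a solution in some difference field extension of `K` has a solution in `K`. (Inequations `g ≠ 0` are
covered, through the equation `g * y = 1` in an additional variable `y`.) -/
def IsExistentiallyClosed {K : Type u} [Field K] (σ : RingAut K) : Prop :=
  ∀ (L : Type u) [Field L] [Algebra K L] (τ : RingAut L), Extends σ τ →
    ∀ (n : ℕ) (S : Finset (MvPolynomial (Fin n × ℤ) K)),
      (∃ a : Fin n → L, ∀ f ∈ S, diffEval K τ a f = 0) →
        ∃ a : Fin n → K, ∀ f ∈ S, diffEval K σ a f = 0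

/-- The function symbols of the language `{+, -, *, 0, 1, σ}` of difference rings. -/
inductive DiffFunc : ℕ → Type
  | zero : DiffFunc 0
  | one : DiffFunc 0
  | neg : DiffFunc 1
  | sigma : DiffFunc 1
  | add : DiffFunc 2
  | mul : DiffFunc 2

/-- The first-order language of difference rings. -/
def diffLanguage : FirstOrder.Language := ⟨DiffFunc, fun _ => Empty⟩

/-- A difference field as a first-order structure. -/
@[reducible]
def diffStructure {K : Type*} [Field K] (σ : RingAut K) : diffLanguage.Structure K where
  funMap := fun f x => match f, x with
    | DiffFunc.zero, _ => 0
    | DiffFunc.one, _ => 1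
    | DiffFunc.neg, x => - x 0
    | DiffFunc.sigma, x => σ (x 0)
    | DiffFunc.add, x => x 0 + x 1
    | DiffFunc.mul, x => x 0 * x 1
  RelMap := fun r _ => nomatch r

/-- `(K, σ)` is `κ`-saturated: every set of first-order formulas in one variable, with parameters in
a set `A` of cardinality `< κ`, which is finitely satisfiable in `K` is satisfiable in `K`. -/
def IsSaturated {K : Type u} [Field K] (σ : RingAut K) (κ : Cardinal.{u}) : Prop :=
  letI := diffStructure σ
  ∀ A : Set K, Cardinal.mk A < κ → ∀ p : Set (diffLanguage.Formula (A ⊕ Unit)),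
    (∀ s : Finset (diffLanguage.Formula (A ⊕ Unit)), ↑s ⊆ p →
      ∃ x : K, ∀ φ ∈ s, φ.Realize (Sum.elim Subtype.val fun _ => x)) →
    ∃ x : K, ∀ φ ∈ p, φ.Realize (Sum.elim Subtype.val fun _ => x)

/-! ### Quantifier-free types, SU-rank, basic and semi-basic types

A quantifier-free type over `k` is always given as the quantifier-free type of some tuple of the
big difference field `(Ω, σ)`. For the reduct `Ω[m]`, use `τ = σ ^ m`. -/

section Types

variable {Ω : Type u} [Field Ω]

/-- `b` realises the quantifier-free type of `a` over `k` in the difference field `(Ω, τ)`: the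
tuples satisfy the same difference equations over `k`. -/
def Realises (k : Type u) [Field k] [Algebra k Ω] (τ : RingAut Ω) {n : ℕ} (a b : Fin n → Ω) : Prop :=
  RingHom.ker (diffEval k τ b) = RingHom.ker (diffEval k τ a)

/-- The field-theoretic algebraic closure, in `Ω`, of the `τ`-difference subfield generated by
`A`. (It contains the perfect closure of that field.) -/
def acl (τ : RingAut Ω) (A : Set Ω) : Subfield Ω :=
  (algebraicClosure (Subfield.closure (⋃ i : ℤ, (τ ^ i) '' A)) Ω).toSubfield

/-- Independence of `A` and `B` over `C` in the difference field `(Ω, τ)`: algebraic independence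
of the fields `acl (A ∪ C)` and `acl (B ∪ C)` over `acl C`. -/
def Indep (τ : RingAut Ω) (A B C : Set Ω) : Prop :=
  ∀ (r : ℕ) (b : Fin r → Ω), (∀ j, b j ∈ acl τ (A ∪ C)) →
    AlgebraicIndependent (acl τ C) b → AlgebraicIndependent (acl τ (B ∪ C)) b

/-- `SU(a/E) ≥ s` in the difference field `(Ω, τ)`, for `s` a natural number; the sets of
parameters have cardinality at most `κ`. -/
def SURankGE (τ : RingAut Ω) (κ : Cardinal.{u}) {n : ℕ} (a : Fin n → Ω) : ℕ → Set Ω → Prop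
  | 0, _ => True
  | s + 1, E => ∃ F : Set Ω, E ⊆ F ∧ Cardinal.mk F ≤ κ ∧
      ¬ Indep τ (Set.range a) F E ∧ SURankGE τ κ a s F

/-- The quantifier-free type of `a` over `k` in `(Ω, τ)` has SU-rank at least `s`: it has a
realisation of SU-rank at least `s` over `k`. -/
def TypeSURankGE (k : Type u) [Field k] [Algebra k Ω] (κ : Cardinal.{u}) (τ : RingAut Ω) {n : ℕ}
    (a : Fin n → Ω) (s : ℕ) : Prop :=
  ∃ b : Fin n → Ω, Realises k τ a b ∧ SURankGE τ κ b s (Set.range (algebraMap k Ω))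

/-- The quantifier-free type of `a` over `k` has eventual SU-rank `1`: the limit of the SU-ranks of
the quantifier-free types of `a` over `k` in the reducts `(Ω, σ ^ m!)` is `1`. -/
def HasEvSURankOne (k : Type u) [Field k] [Algebra k Ω] (κ : Cardinal.{u}) (σ : RingAut Ω) {n : ℕ}
    (a : Fin n → Ω) : Prop :=
  ∀ᶠ m : ℕ in Filter.atTop, TypeSURankGE k κ (σ ^ m.factorial) a 1 ∧ ¬ TypeSURankGE k κ (σ ^ m.factorial) a 2

/-- The field `k(a)`. -/
abbrev gen (k : Type u) [Field k] [Algebra k Ω] {n : ℕ} (a : Fin n → Ω) : IntermediateField k Ω :=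
  IntermediateField.adjoin k (Set.range a)

/-- The inversive difference field `k(a)_σ`. -/
abbrev genσ (k : Type u) [Field k] [Algebra k Ω] (σ : RingAut Ω) {n : ℕ} (a : Fin n → Ω) :
    IntermediateField k Ω :=
  IntermediateField.adjoin k (Set.range fun p : Fin n × ℤ => (σ ^ p.2) (a p.1))

theorem gen_le_genσ (k : Type u) [Field k] [Algebra k Ω] (σ : RingAut Ω) {n : ℕ} (a : Fin n → Ω) :
    gen k a ≤ genσ k σ a := by
  apply IntermediateField.adjoin.mono
  rintro _ ⟨j, rfl⟩
  exact ⟨(j, 0), by simp⟩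

/-- The quantifier-free type of `a` over `k` satisfies (ALG`m`): `σ ^ m (b)` is algebraic over `k(b)`
for all its realisations `b`. -/
def SatisfiesALG (k : Type u) [Field k] [Algebra k Ω] (σ : RingAut Ω) (m : ℕ) {n : ℕ}
    (a : Fin n → Ω) : Prop :=
  ∀ b : Fin n → Ω, Realises k σ a b → ∀ j, IsAlgebraic (gen k b) ((σ ^ m) (b j))

/-- The quantifier-free type of `a` over `k` is basic. -/
def IsBasic (k : Type u) [Field k] [Algebra k Ω] (κ : Cardinal.{u}) (σ : RingAut Ω) {n : ℕ}
    (a : Fin n → Ω) : Prop :=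
  HasEvSURankOne k κ σ a ∧ ∃ m : ℕ, 1 ≤ m ∧ SatisfiesALG k σ m a

/-- The tuples `a i` are algebraically independent from each other over `k`: choosing in each of
them some coordinates which are algebraically independent over `k`, one obtains a family which is
algebraically independent over `k`. -/
def TuplesIndependent (k : Type u) [Field k] [Algebra k Ω] {r : ℕ} {d : Fin r → ℕ}
    (a : ∀ i, Fin (d i) → Ω) : Prop :=
  ∀ s : ∀ i, Set (Fin (d i)), (∀ i, AlgebraicIndependent k fun j : s i => a i j) →
    AlgebraicIndependent k fun p : Σ i, s i => a p.1 p.2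

/-- The quantifier-free type of `a` over `k` is semi-basic: each of its realisations `b` is
equi-algebraic over `k` with a finite independent sequence `c` of realisations of basic types. -/
def IsSemiBasic (k : Type u) [Field k] [Algebra k Ω] (κ : Cardinal.{u}) (σ : RingAut Ω) {n : ℕ}
    (a : Fin n → Ω) : Prop :=
  ∀ b : Fin n → Ω, Realises k σ a b →
    ∃ (r : ℕ) (d : Fin r → ℕ) (c : ∀ i, Fin (d i) → Ω), 1 ≤ r ∧
      (∀ i j, IsAlgebraic (gen k b) (c i j)) ∧
      (∀ i, IsBasic k κ σ (c i)) ∧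
      TuplesIndependent k c ∧
      ∀ j, IsAlgebraic
        (IntermediateField.adjoin k (Set.range fun p : Σ i, Fin (d i) => c p.1 p.2)) (b j)

end Types

/-! ### Coordinate rings -/

section CoordinateRings

variable (k K : Type u) {Ω : Type u} [Field k] [Field K] [Field Ω] [Algebra k K] [Algebra k Ω]

/-- The coordinate ring `R_q = K{x} = K ⊗ k(x)` of the quantifier-free type `q` of `a` over `k`; the
field `k(x)` is realised as the subfield `k(a)` of `Ω`. -/
abbrev Coord {n : ℕ} (a : Fin n → Ω) : Type u := K ⊗[k] gen k a

/-- The coordinate ring `R_{q,σ} = K{x}_σ = K ⊗ k(x)_σ` of the quantifier-free type `q` of `a`. -/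
abbrev Coordσ (σ : RingAut Ω) {n : ℕ} (a : Fin n → Ω) : Type u := K ⊗[k] genσ k σ a

/-- The inclusion of `K{x}` in `K{x}_σ`. -/
def coordIncl (σ : RingAut Ω) {n : ℕ} (a : Fin n → Ω) : Coord k K a →ₐ[K] Coordσ k K σ a :=
  Algebra.TensorProduct.map (AlgHom.id K K) (IntermediateField.inclusion (gen_le_genσ k σ a))

/-- The tensor product over `K` of a family of commutative `K`-algebras, as a commutative
`K`-algebra. -/
abbrev AlgTensor {N : ℕ} (A : Fin N → Type u) [∀ i, CommRing (A i)] [∀ i, Algebra K (A i)] :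
    Type u := ⨂[K] i, A i

/-- The tensor product of a family of homomorphisms of commutative `K`-algebras. -/
def algTensorMap {N : ℕ} {A B : Fin N → Type u} [∀ i, CommRing (A i)] [∀ i, Algebra K (A i)]
    [∀ i, CommRing (B i)] [∀ i, Algebra K (B i)] (f : ∀ i, A i →ₐ[K] B i) :
    AlgTensor K A →ₐ[K] AlgTensor K B :=
  PiTensorProduct.liftAlgHom
    ((PiTensorProduct.tprod K).compLinearMap fun i => (f i).toLinearMap)
    (by simp [PiTensorProduct.one_def, Pi.one_def])
    (by intro x y; simp [PiTensorProduct.tprod_mul_tprod, Pi.mul_def])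

variable {N : ℕ} {d : Fin N → ℕ}

/-- The coordinate ring `R = K{x_1} ⊗ ⋯ ⊗ K{x_N}` (tensor product over `K`). -/
abbrev CoordRing (a : ∀ i, Fin (d i) → Ω) : Type u := AlgTensor K fun i => Coord k K (a i)

/-- The coordinate ring `R_σ = K{x_1}_σ ⊗ ⋯ ⊗ K{x_N}_σ` (tensor product over `K`). -/
abbrev CoordRingσ (σ : RingAut Ω) (a : ∀ i, Fin (d i) → Ω) : Type u :=
  AlgTensor K fun i => Coordσ k K σ (a i)

/-- The inclusion of `R` in `R_σ`. -/
def coordRingIncl (σ : RingAut Ω) (a : ∀ i, Fin (d i) → Ω) :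
    CoordRing k K a →ₐ[K] CoordRingσ k K σ a :=
  algTensorMap K fun i => coordIncl k K σ (a i)

end CoordinateRings

/-- All fibres of `Spec A → Spec B` have at most `g` elements. -/
def FibresLE (B A : Type*) [CommRing B] [CommRing A] [Algebra B A] (g : ℕ) : Prop :=
  ∀ p : PrimeSpectrum B,
    {q : PrimeSpectrum A | PrimeSpectrum.comap (algebraMap B A) q = p}.encard ≤ g

/-- The integral closure of a ring in its total ring of fractions. -/
abbrev Normalization (B : Type*) [CommRing B] : Type _ := integralClosure B (FractionRing B)

/-- The prime ideals of `S` which extend the ideal `P` of `R` and are contained in `Q`. -/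
def primesOverBelow {R S : Type*} [CommRing R] [CommRing S] (ι : R →+* S) (P : Ideal R)
    (Q : Ideal S) : Set (Ideal S) :=
  {P' | P'.IsPrime ∧ P'.comap ι = P ∧ P' ≤ Q}

end

end VirtualDifference

/-! By (ALG1), each `k₀(x_i)_σ` is algebraic over `k₀(x_i)`, so `R_σ` is integral over `R` and is
generated by elements integral over subfields of `R`. Since `K` is algebraically closed and
saturated, `Q` lies in the kernel of a `K`-rational point `π` of `R_σ`. It then suffices to count
the primes `P'` over `P` that lie below `π`.

Let `M` be the fraction field of `R/P`, `N` its algebraic closure and `C` the integral closure of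
`R` in `N`. Each `R_σ/P'` embeds in `C` over `R`, through some `φ` with kernel `P'`, and `π` extends
along `φ` to a point `ψ : C → K`. Send `P'` to the trace of `ker ψ` on the normalization of `R/P`;
this trace lies over the trace of `π` on `R/P`. If `P₁` and `P₂` have the same image, some
automorphism `τ` of `N` over `M` carries one kernel to the other, and rationality over `K` gives `ψ₁
∘ τ = ψ₂`. Hence `φ₁` and `τ ∘ φ₂` agree after `ψ₁`. They must be equal: a nonzero difference of two
values at a generator would be algebraic over a subfield, hence a unit of `C`, which `ψ₁` cannot
kill. So `P₁ = P₂`, and the primes inject into one fibre (`exists_injOn_primes_integralClosure`).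

The fibres are bounded because `R/P` is a localization of a finitely generated `K`-algebra: Noether
normalization and the same conjugacy theorem bound them by a number of field embeddings
(`exists_fibresLE_of_finite`). -/

namespace VirtualDifference

/-! ### Conjugacy of primes in integral closures -/

section Transitivity

variable {R N : Type*} [CommRing R] [Field N] [Algebra R N]

/-- The action of the automorphisms of a field extension on an integral closure. -/
@[reducible]
def integralClosureAction (F : Type*) [Field F] [Algebra F N] [Algebra R F] [IsScalarTower R F N] :
    MulSemiringAction (N ≃ₐ[F] N) (integralClosure R N) where
  smul g x := ⟨g x, x.2.map (g.restrictScalars R : N →ₐ[R] N)⟩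
  one_smul _ := rfl
  mul_smul _ _ _ := rfl
  smul_zero g := Subtype.ext (map_zero g)
  smul_add g x y := Subtype.ext (map_add g (x : N) y)
  smul_one g := Subtype.ext (map_one g)
  smul_mul g x y := Subtype.ext (map_mul g (x : N) y)

/-- A profinite group permutes transitively the primes with a given trace on the ring of invariants.
By Galois theory the invariants are exactly the integral elements lying in `F`. -/
theorem exists_algEquiv_of_isGalois (F : Type*) [Field F] [Algebra F N] [Algebra R F]
    [IsScalarTower R F N] [IsGalois F N] (Q₁ Q₂ : Ideal (integralClosure R N)) [Q₁.IsPrime]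
    [Q₂.IsPrime] (h : ∀ x : integralClosure R N, (x : N) ∈ (algebraMap F N).range →
      (x ∈ Q₁ ↔ x ∈ Q₂)) :
    ∃ τ : N ≃ₐ[F] N, ∀ x y : integralClosure R N, (y : N) = τ x → (x ∈ Q₁ ↔ y ∈ Q₂) := by
  let := integralClosureAction (R := R) (N := N) F
  -- For the discrete topology, continuity of the action means that stabilizers are open, which
  -- holds because elements of `N` are algebraic over `F`.
  let : TopologicalSpace (integralClosure R N) := ⊥
  have : DiscreteTopology (integralClosure R N) := ⟨rfl⟩
  have : SMulCommClass (N ≃ₐ[F] N) R (integralClosure R N) :=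
    ⟨fun g r x => Subtype.ext (map_smul (g.restrictScalars R) r (x : N))⟩
  have : Algebra.IsInvariant (FixedPoints.subalgebra R (integralClosure R N) (N ≃ₐ[F] N))
      (integralClosure R N) (N ≃ₐ[F] N) := ⟨fun b hb => ⟨⟨b, hb⟩, rfl⟩⟩
  have : ContinuousSMul (N ≃ₐ[F] N) (integralClosure R N) := by
    refine continuousSMul_iff_stabilizer_isOpen.mpr fun x => ?_
    convert stabilizer_isOpen_of_isIntegral (K := F) (x : N) using 1
    ext g
    simp only [SetLike.mem_coe, MulAction.mem_stabilizer_iff]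
    exact Subtype.ext_iff
  obtain ⟨g, hg⟩ := Algebra.IsInvariant.exists_smul_of_under_eq_of_profinite
    (A := FixedPoints.subalgebra R (integralClosure R N) (N ≃ₐ[F] N)) (G := N ≃ₐ[F] N) Q₁ Q₂ (by
      ext x
      refine h x.1 ?_
      have h1 : ((x.1 : integralClosure R N) : N) ∈ (⊥ : IntermediateField F N) := by
        rw [InfiniteGalois.mem_bot_iff_fixed]
        exact fun f => congrArg Subtype.val (x.2 f)
      exact IntermediateField.mem_bot.mp h1)
  refine ⟨g, fun x y hxy => ?_⟩
  obtain rfl : y = g • x := Subtype.ext hxy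
  rw [hg, Ideal.smul_mem_pointwise_smul_iff]

/-- The automorphisms of an algebraically closed algebraic extension `N` of a field `M` act
transitively on the primes of an integral closure in `N` which have the same trace on `M`. -/
theorem exists_algEquiv_of_isAlgClosed (M : Type*) [Field M] [Algebra M N] [Algebra R M]
    [IsScalarTower R M N] [IsAlgClosed N] [Algebra.IsAlgebraic M N]
    (Q₁ Q₂ : Ideal (integralClosure R N)) [Q₁.IsPrime]
    [Q₂.IsPrime] (h : ∀ x : integralClosure R N, (x : N) ∈ (algebraMap M N).range →
      (x ∈ Q₁ ↔ x ∈ Q₂)) :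
    ∃ τ : N ≃ₐ[M] N, ∀ x y : integralClosure R N, (y : N) = τ x → (x ∈ Q₁ ↔ y ∈ Q₂) := by
  -- `N` may be inseparable over `M`, but it is Galois over the perfect closure of `M` in `N`.
  have : IsScalarTower R (perfectClosure M N) N :=
    ⟨fun r x y => by
      rw [IntermediateField.smul_def, IntermediateField.smul_def]
      exact smul_assoc r (x : N) y⟩
  have : Algebra.IsAlgebraic (perfectClosure M N) N := Algebra.IsAlgebraic.tower_top (K := M) _
  have : IsAlgClosure (perfectClosure M N) N := ⟨‹_›, ‹_›⟩
  have : Normal (perfectClosure M N) N := IsAlgClosure.normal _ _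
  have : IsGalois (perfectClosure M N) N := IsGalois.mk
  obtain ⟨τ, hτ⟩ := exists_algEquiv_of_isGalois (perfectClosure M N) Q₁ Q₂ (by
    rintro x ⟨y, hy⟩
    obtain ⟨q, hq⟩ := ExpChar.exists M
    obtain ⟨n, z, hz⟩ := (mem_perfectClosure_iff_pow_mem q).mp y.2
    have hy' : (x : N) = y := hy.symm
    -- A prime contains `x` exactly when it contains this power, which lies in `M`.
    have := h (x ^ q ^ n) ⟨z, by rw [hz, ← hy']; rfl⟩
    have hpos : 0 < q ^ n := pow_pos (expChar_pos M q) n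
    rwa [Ideal.IsPrime.pow_mem_iff_mem ‹_› _ hpos, Ideal.IsPrime.pow_mem_iff_mem ‹_› _ hpos] at this)
  exact ⟨τ.restrictScalars M, hτ⟩

end Transitivity

/-! ### Rigidity of homomorphisms on elements algebraic over a subfield -/

section Core

variable {R S M N K : Type*} [CommRing R] [CommRing S] [Algebra R S] [Field M] [Field N] [Field K]
  [Algebra R M] [Algebra M N] [Algebra R N] [IsScalarTower R M N]

/-- Two homomorphisms to an integral closure, which become equal over a field, agree on the
elements which are integral over a subfield. -/
theorem algHom_apply_eq_of_isIntegral {F : Type*} [Field F] (f : F →+* R)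
    (φ₁ φ₂ : S →ₐ[R] integralClosure R N) (ψ : integralClosure R N →+* K)
    (h : ∀ s, ψ (φ₁ s) = ψ (φ₂ s)) {s : S} (hs : ((algebraMap R S).comp f).IsIntegralElem s) :
    φ₁ s = φ₂ s := by
  let : Algebra F N := ((algebraMap R N).comp f).toAlgebra
  have key : ∀ φ : S →ₐ[R] integralClosure R N, IsIntegral F (φ s : N) := by
    intro φ
    have h1 := hs.map ((integralClosure R N).val.toRingHom.comp φ.toRingHom)
    have h2 : ((integralClosure R N).val.toRingHom.comp φ.toRingHom).comp
        ((algebraMap R S).comp f) = algebraMap F N := by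
      ext x
      simp [RingHom.algebraMap_toAlgebra]
    rwa [h2] at h1
  by_contra hne
  have hδ : IsIntegral F ((φ₁ s : N) - φ₂ s) := (key φ₁).sub (key φ₂)
  have hδ0 : (φ₁ s : N) - φ₂ s ≠ 0 := fun h0 => hne (Subtype.ext (sub_eq_zero.mp h0))
  -- Over a field, the inverse of an algebraic element is again integral. So the difference is a
  -- unit of the integral closure, although `ψ` sends it to zero.
  have hinv : IsIntegral R ((φ₁ s : N) - φ₂ s)⁻¹ := by
    obtain ⟨p, hp, hp'⟩ := hδ.inv
    exact ⟨p.map f, hp.map f, by rw [Polynomial.eval₂_map]; exact hp'⟩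
  have hmul : (φ₁ s - φ₂ s) * ⟨_, hinv⟩ = 1 := Subtype.ext (mul_inv_cancel₀ hδ0)
  have := congrArg ψ hmul
  rw [map_mul, map_sub, h s, sub_self, zero_mul, map_one] at this
  exact zero_ne_one this

end Core

/-! ### Extending points along integral homomorphisms -/

section Extension

/-- A homomorphism to an algebraically closed field extends along an integral homomorphism, with any
prescribed kernel over its own. -/
theorem exists_ringHom_ker_eq {D E K : Type*} [CommRing D] [CommRing E] [Field K] [IsAlgClosed K]
    {ι : D →+* E} (hι : ι.IsIntegral) (f : D →+* K) (I : Ideal E) [I.IsPrime]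
    (h : I.comap ι = RingHom.ker f) : ∃ g : E →+* K, g.comp ι = f ∧ RingHom.ker g = I := by
  have : (RingHom.ker f).IsPrime := RingHom.ker_isPrime f
  let j : D ⧸ RingHom.ker f →+* E ⧸ I := Ideal.quotientMap I ι h.ge
  have hj : Function.Injective j := Ideal.quotientMap_injective' h.le
  let _ : Algebra (D ⧸ RingHom.ker f) (E ⧸ I) := j.toAlgebra
  let _ : Algebra (D ⧸ RingHom.ker f) K := f.kerLift.toAlgebra
  have : Module.IsTorsionFree (D ⧸ RingHom.ker f) (E ⧸ I) :=
    Module.isTorsionFree_iff_algebraMap_injective.mpr hj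
  have : Module.IsTorsionFree (D ⧸ RingHom.ker f) K :=
    Module.isTorsionFree_iff_algebraMap_injective.mpr f.kerLift_injective
  have hint : Algebra.IsIntegral (D ⧸ RingHom.ker f) (E ⧸ I) := by
    refine algebraMap_isIntegral_iff.mp (RingHom.IsIntegral.tower_top (Ideal.Quotient.mk _) j ?_)
    exact (hι.trans _ _ (RingHom.isIntegral_of_surjective _ Ideal.Quotient.mk_surjective) :
      ((Ideal.Quotient.mk I).comp ι).IsIntegral)
  let g : E ⧸ I →ₐ[D ⧸ RingHom.ker f] K := IsAlgClosed.lift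
  -- In an integral extension of domains, an ideal with zero trace below is zero.
  have hg : RingHom.ker g.toRingHom = ⊥ := by
    refine Ideal.eq_bot_of_comap_eq_bot (R := D ⧸ RingHom.ker f) ?_
    rw [RingHom.comap_ker]
    have : g.toRingHom.comp (algebraMap (D ⧸ RingHom.ker f) (E ⧸ I)) = f.kerLift :=
      g.comp_algebraMap
    rw [this]
    exact (RingHom.injective_iff_ker_eq_bot _).mp f.kerLift_injective
  refine ⟨g.toRingHom.comp (Ideal.Quotient.mk I), ?_, ?_⟩
  · ext x
    exact g.commutes (Ideal.Quotient.mk _ x)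
  · rw [← RingHom.comap_ker, hg, ← RingHom.ker_eq_comap_bot, Ideal.mk_ker]

/-- A homomorphism to an algebraically closed field extends along an integral homomorphism. -/
theorem exists_ringHom_comp_eq {D E K : Type*} [CommRing D] [CommRing E] [Field K] [IsAlgClosed K]
    {ι : D →+* E} (hι : ι.IsIntegral) (f : D →+* K) (h : RingHom.ker ι ≤ RingHom.ker f) :
    ∃ g : E →+* K, g.comp ι = f := by
  have : (RingHom.ker f).IsPrime := RingHom.ker_isPrime f
  let _ := ι.toAlgebra
  have : Algebra.IsIntegral D E := ⟨hι⟩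
  obtain ⟨I, -, hI, hI'⟩ := Ideal.exists_ideal_over_prime_of_isIntegral (RingHom.ker f) (⊥ : Ideal E) h
  obtain ⟨g, hg, -⟩ := exists_ringHom_ker_eq hι f I hI'
  exact ⟨g, hg⟩

end Extension

/-! ### From primes below a rational point to a fibre of the integral closure -/

section Injection

variable {R S M K : Type*} [CommRing R] [CommRing S] [Algebra R S] [Field M] [Field K]
  [Algebra R M]

/-- For a ring `S` integral over `R` and generated by elements integral over subfields of `R`, the
primes of `S` which lie over the kernel of `R → M` and below a `K`-rational point of `S` inject into
the primes of the integral closure of `R` in `M` which lie below the point. -/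
theorem exists_injOn_primes_integralClosure [IsAlgClosed K] [Algebra.IsIntegral R S]
    [Algebra K R] [Algebra K S] [IsScalarTower K R S] {G : Set S} (hG : Algebra.adjoin R G = ⊤)
    (hGF : ∀ s ∈ G, ∃ (F : Type u) (_ : Field F) (f : F →+* R),
      ((algebraMap R S).comp f).IsIntegralElem s)
    (π : S →ₐ[K] K) (Q : Ideal S) (hQ : Q ≤ RingHom.ker π) :
    ∃ α : {P' : Ideal S | P'.IsPrime ∧
        P'.comap (algebraMap R S) = RingHom.ker (algebraMap R M) ∧ P' ≤ Q} →
        PrimeSpectrum (integralClosure R M), Function.Injective α ∧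
      ∀ P', (α P').asIdeal.comap (algebraMap R (integralClosure R M)) =
          (RingHom.ker π).comap (algebraMap R S) := by
  let N := AlgebraicClosure M
  let C := integralClosure R N
  have key : ∀ P' : {P' : Ideal S | P'.IsPrime ∧
      P'.comap (algebraMap R S) = RingHom.ker (algebraMap R M) ∧ P' ≤ Q},
      ∃ (φ : S →ₐ[R] C) (ψ : C →+* K), RingHom.ker φ = P' ∧ ∀ s, ψ (φ s) = π s := by
    rintro ⟨P', hP', hP'M, hP'Q⟩
    obtain ⟨g, hg, hgk⟩ := exists_ringHom_ker_eq (K := N)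
      (algebraMap_isIntegral_iff.mpr ‹Algebra.IsIntegral R S›)
      ((algebraMap M N).comp (algebraMap R M)) P' (by
        rw [hP'M, RingHom.ker_comp_of_injective _ (algebraMap M N).injective])
    rw [← IsScalarTower.algebraMap_eq] at hg
    let g' : S →ₐ[R] N := { g with commutes' := fun r => RingHom.congr_fun hg r }
    let φ : S →ₐ[R] C := g'.codRestrict (integralClosure R N)
      fun s => (Algebra.IsIntegral.isIntegral s).map g'
    have hφ : RingHom.ker φ = P' := by
      rw [← hgk]
      ext s
      rw [RingHom.mem_ker, RingHom.mem_ker]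
      exact Subtype.ext_iff
    have hφi : (φ : S →+* C).IsIntegral := by
      apply RingHom.IsIntegral.tower_top (algebraMap R S)
      have : (φ : S →+* C).comp (algebraMap R S) = algebraMap R C := φ.comp_algebraMap
      rw [this]
      exact algebraMap_isIntegral_iff.mpr inferInstance
    -- Since `P' ≤ Q ≤ ker π`, the point `π` factors through the image of `φ`, over which `C` is
    -- integral.
    obtain ⟨ψ, hψ⟩ := exists_ringHom_comp_eq hφi (π : S →+* K) (hφ.le.trans (hP'Q.trans hQ))
    exact ⟨φ, ψ, hφ, fun s => RingHom.congr_fun hψ s⟩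
  choose φ ψ hφ hψ using key
  let j : integralClosure R M →ₐ[R] C :=
    ((IsScalarTower.toAlgHom R M N).comp (integralClosure R M).val).codRestrict _
      fun x => x.2.map (IsScalarTower.toAlgHom R M N)
  have hprime : ∀ P', (RingHom.ker (ψ P')).IsPrime := fun P' => RingHom.ker_isPrime _
  refine ⟨fun P' => ⟨(RingHom.ker (ψ P')).comap j, Ideal.comap_isPrime _ _⟩, ?_, fun P' => ?_⟩
  · rintro P₁ P₂ hα
    obtain ⟨τ, hτ⟩ := exists_algEquiv_of_isAlgClosed M (RingHom.ker (ψ P₂)) (RingHom.ker (ψ P₁)) (by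
      rintro x ⟨y, hy⟩
      have hyint : IsIntegral R y :=
        (isIntegral_algebraMap_iff (algebraMap M N).injective).mp (hy ▸ x.2)
      have hx : j ⟨y, hyint⟩ = x := Subtype.ext hy
      have := SetLike.ext_iff.mp (congrArg PrimeSpectrum.asIdeal hα) ⟨y, hyint⟩
      rw [← hx]
      exact this.symm)
    let τ' : C →ₐ[R] C := ((τ.restrictScalars R : N →ₐ[R] N).comp (integralClosure R N).val).codRestrict
      _ fun x => x.2.map (τ.restrictScalars R : N →ₐ[R] N)
    have hτinj : Function.Injective τ' := fun x y hxy =>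
      Subtype.ext (τ.injective (congrArg Subtype.val hxy))
    have hK : ∀ P' (c : K), ψ P' (algebraMap R C (algebraMap K R c)) = c := by
      intro P' c
      rw [← (φ P').commutes, hψ, ← IsScalarTower.algebraMap_apply, π.commutes]
      rfl
    have hψτ : ∀ x : C, ψ P₁ (τ' x) = ψ P₂ x := by
      intro x
      -- As both points are `K`-rational, an element minus its value lies in the kernel; conjugate
      -- kernels therefore give conjugate homomorphisms.
      have hx : x - algebraMap R C (algebraMap K R (ψ P₂ x)) ∈ RingHom.ker (ψ P₂) := by
        rw [RingHom.mem_ker, map_sub, hK, sub_self]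
      rw [hτ _ (τ' _) rfl, RingHom.mem_ker, map_sub, τ'.commutes, map_sub, hK,
        sub_eq_zero] at hx
      exact hx
    have heq : φ P₁ = τ'.comp (φ P₂) := by
      refine AlgHom.ext_of_adjoin_eq_top hG fun s hs => ?_
      obtain ⟨F, _, f, hf⟩ := hGF s hs
      refine algHom_apply_eq_of_isIntegral f _ _ (ψ P₁) (fun s => ?_) hf
      rw [AlgHom.comp_apply, hψτ, hψ, hψ]
    refine Subtype.ext ?_
    rw [← hφ P₁, ← hφ P₂, heq]
    ext s
    rw [RingHom.mem_ker, RingHom.mem_ker, AlgHom.comp_apply, map_eq_zero_iff _ hτinj]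
  · ext r
    simp only [Ideal.mem_comap, RingHom.mem_ker, j.commutes]
    rw [← (φ P').commutes, hψ]

end Injection

/-! ### Bounded fibres of normalizations -/

section Fibres

/-- If every element of the field `M` is a quotient of elements of a finite `Z`-algebra, then `M` is
finite over any subfield that contains `Z`. -/
theorem finiteDimensional_of_forall_eq_div {Z B L M : Type*} [CommRing Z] [CommRing B] [Field L]
    [Field M] [Algebra Z B] [Algebra Z L] [Algebra L M] [Algebra B M] [Algebra Z M]
    [IsScalarTower Z L M] [IsScalarTower Z B M] [Module.Finite Z B]
    (h : ∀ m : M, ∃ x y : B, m = algebraMap B M x / algebraMap B M y) : FiniteDimensional L M := by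
  obtain ⟨t, ht⟩ := Module.Finite.fg_top (R := Z) (M := B)
  let E := IntermediateField.adjoin L (algebraMap B M '' t)
  have hE : FiniteDimensional L E := by
    have : Finite (algebraMap B M '' t) := (t.finite_toSet.image _).to_subtype
    refine IntermediateField.finiteDimensional_adjoin ?_
    rintro _ ⟨x, -, rfl⟩
    exact ((Algebra.IsIntegral.isIntegral (R := Z) x).algebraMap (B := M)).tower_top
  have hB : ∀ x : B, algebraMap B M x ∈ E := by
    intro x
    have hx : x ∈ Submodule.span Z (t : Set B) := ht ▸ Submodule.mem_top
    induction hx using Submodule.span_induction with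
    | mem x hx => exact IntermediateField.subset_adjoin _ _ ⟨x, hx, rfl⟩
    | zero => rw [map_zero]; exact zero_mem _
    | add x y _ _ hx hy => rw [map_add]; exact add_mem hx hy
    | smul a x _ hx =>
      rw [Algebra.smul_def, map_mul, ← IsScalarTower.algebraMap_apply,
        IsScalarTower.algebraMap_apply Z L M]
      exact mul_mem (E.algebraMap_mem _) hx
  have htop : E = ⊤ := by
    rw [eq_top_iff]
    intro m _
    obtain ⟨x, y, rfl⟩ := h m
    exact div_mem (hB x) (hB y)
  rw [htop] at hE
  exact Module.Finite.equiv (IntermediateField.topEquiv (F := L) (E := M)).toLinearEquiv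

/-- The fibres of the normalization of a localization of a finite extension of an integrally closed
domain are bounded. -/
theorem exists_fibresLE_of_finite (Z B₀ B : Type*) [CommRing Z] [IsDomain Z] [IsIntegrallyClosed Z]
    [CommRing B₀] [CommRing B] [IsDomain B] [Algebra Z B₀] [Algebra B₀ B] [Algebra Z B]
    [IsScalarTower Z B₀ B] [Module.Finite Z B₀] [FaithfulSMul Z B] [FaithfulSMul B₀ B]
    (h : ∀ b : B, ∃ s y : B₀, IsUnit (algebraMap B₀ B s) ∧ algebraMap B₀ B s * b = algebraMap B₀ B y) :
    ∃ g : ℕ, FibresLE B (Normalization B) g := by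
  let M := FractionRing B
  let L := FractionRing Z
  have : FaithfulSMul Z M := (faithfulSMul_iff_algebraMap_injective _ _).mpr <| by
    rw [IsScalarTower.algebraMap_eq Z B M]
    exact (IsFractionRing.injective B M).comp (FaithfulSMul.algebraMap_injective Z B)
  let _ : Algebra L M := FractionRing.liftAlgebra Z M
  have : IsScalarTower Z L M := FractionRing.isScalarTower_liftAlgebra Z M
  have hfin : FiniteDimensional L M := by
    refine finiteDimensional_of_forall_eq_div (Z := Z) (B := B₀) fun m => ?_
    obtain ⟨b, c, hc, rfl⟩ := IsFractionRing.div_surjective B m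
    obtain ⟨s, x, hs, hx⟩ := h b
    obtain ⟨t, y, ht, hy⟩ := h c
    have hs' : algebraMap B₀ M s ≠ 0 := by
      rw [IsScalarTower.algebraMap_apply B₀ B M]
      exact (hs.map (algebraMap B M)).ne_zero
    have ht' : algebraMap B₀ M t ≠ 0 := by
      rw [IsScalarTower.algebraMap_apply B₀ B M]
      exact (ht.map (algebraMap B M)).ne_zero
    have hc' : algebraMap B M c ≠ 0 :=
      fun h0 => nonZeroDivisors.ne_zero hc ((IsFractionRing.injective B M) (h0.trans (map_zero _).symm))
    have hx' := congrArg (algebraMap B M) hx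
    have hy' := congrArg (algebraMap B M) hy
    rw [map_mul, ← IsScalarTower.algebraMap_apply, ← IsScalarTower.algebraMap_apply] at hx' hy'
    refine ⟨x * t, y * s, ?_⟩
    rw [map_mul, map_mul, ← hx', ← hy']
    rw [div_eq_div_iff hc' (mul_ne_zero (mul_ne_zero ht' hc') hs')]
    ring
  let N := AlgebraicClosure M
  have : IsScalarTower L M N := inferInstance
  have : IsScalarTower Z L N := .to₁₂₄ Z L M N
  have : Algebra.IsAlgebraic L N := Algebra.IsAlgebraic.trans L M N
  let i : integralClosure Z M →+* Normalization B :=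
    (integralClosure Z M).val.toRingHom.codRestrict (integralClosure B M) fun x => x.2.tower_top
  let j : integralClosure Z M →+* integralClosure Z N :=
    ((algebraMap M N).comp (integralClosure Z M).val.toRingHom).codRestrict (integralClosure Z N)
      fun x => x.2.map (IsScalarTower.toAlgHom Z M N)
  have hj : j.IsIntegral := by
    refine RingHom.IsIntegral.tower_top (algebraMap Z _) j ?_
    have : j.comp (algebraMap Z _) = algebraMap Z (integralClosure Z N) := by
      ext z
      exact (IsScalarTower.algebraMap_apply Z M N z).symm
    rw [this]
    exact algebraMap_isIntegral_iff.mpr inferInstance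
  have hjinj : Function.Injective j := fun x y hxy =>
    Subtype.ext ((algebraMap M N).injective (congrArg Subtype.val hxy))
  have hlift : ∀ q : PrimeSpectrum (Normalization B),
      ∃ q' : Ideal (integralClosure Z N), q'.IsPrime ∧ q'.comap j = q.asIdeal.comap i := by
    intro q
    let _ := j.toAlgebra
    have : Algebra.IsIntegral (integralClosure Z M) (integralClosure Z N) := ⟨hj⟩
    obtain ⟨q', -, h1, h2⟩ := Ideal.exists_ideal_over_prime_of_isIntegral (q.asIdeal.comap i)
      (⊥ : Ideal (integralClosure Z N)) (by
        intro x hx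
        have : x = 0 := hjinj (hx.trans (map_zero _).symm)
        rw [this]
        exact zero_mem _)
    exact ⟨q', h1, h2⟩
  choose q' hq' hqq' using hlift
  -- The bound is the number of `L`-embeddings of `M` in `N`, finite because `M` is finite over `L`.
  -- A point `q` of the fibre will correspond to the restriction to `M` of an automorphism taking
  -- its lift `q' q` to that of a fixed `q₀`.
  refine ⟨Nat.card (M →ₐ[L] N), fun p => ?_⟩
  rcases Set.eq_empty_or_nonempty {q : PrimeSpectrum (Normalization B) |
    PrimeSpectrum.comap (algebraMap B (Normalization B)) q = p} with he | ⟨q₀, hq₀⟩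
  · rw [he, Set.encard_empty]
    exact zero_le
  have hmem : ∀ q : PrimeSpectrum (Normalization B),
      PrimeSpectrum.comap (algebraMap B (Normalization B)) q = p → ∀ z : Z,
      algebraMap Z _ z ∈ q' q ↔ algebraMap Z B z ∈ p.asIdeal := by
    rintro q rfl z
    have h1 : algebraMap Z (integralClosure Z N) z = j (algebraMap Z _ z) :=
      Subtype.ext (IsScalarTower.algebraMap_apply Z M N z)
    have h2 : i (algebraMap Z _ z) = algebraMap B _ (algebraMap Z B z) :=
      Subtype.ext (IsScalarTower.algebraMap_apply Z B M z)
    rw [h1, ← Ideal.mem_comap, hqq', Ideal.mem_comap, h2]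
    rfl
  have hτ : ∀ q : {q : PrimeSpectrum (Normalization B) |
      PrimeSpectrum.comap (algebraMap B (Normalization B)) q = p}, ∃ τ : N ≃ₐ[L] N,
      ∀ x y : integralClosure Z N, (y : N) = τ x → (x ∈ q' q ↔ y ∈ q' q₀) := by
    rintro ⟨q, hq⟩
    have := hq' q
    have := hq' q₀
    refine exists_algEquiv_of_isAlgClosed L (q' q) (q' q₀) ?_
    rintro x ⟨l, hl⟩
    have hlint : IsIntegral Z l :=
      (isIntegral_algebraMap_iff (algebraMap L N).injective).mp (hl ▸ x.2)
    -- As `Z` is integrally closed, the trace on `L` is a trace on `Z`, and this depends only on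
    -- `p`.
    obtain ⟨z, rfl⟩ := IsIntegrallyClosed.isIntegral_iff.mp hlint
    have hx : x = algebraMap Z _ z :=
      Subtype.ext (hl.symm.trans (IsScalarTower.algebraMap_apply Z L N z).symm)
    rw [hx, hmem q hq, hmem q₀ hq₀]
  choose τ hτ using hτ
  have hinj : Function.Injective fun q : {q : PrimeSpectrum (Normalization B) |
      PrimeSpectrum.comap (algebraMap B (Normalization B)) q = p} =>
      (τ q : N →ₐ[L] N).comp (IsScalarTower.toAlgHom L M N) := by
    intro q₁ q₂ h12
    -- The restriction of `τ q` to `M` determines the trace of `q` on the integral closure of `Z` in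
    -- `M`, as the preimage of `q' q₀`.
    have h0 : ∀ x : integralClosure Z M, i x ∈ q₁.1.asIdeal ↔ i x ∈ q₂.1.asIdeal := by
      have aux : ∀ q : {q : PrimeSpectrum (Normalization B) |
          PrimeSpectrum.comap (algebraMap B (Normalization B)) q = p}, ∀ x : integralClosure Z M,
          i x ∈ q.1.asIdeal ↔ ∃ y ∈ q' q₀, (y : N) = τ q (algebraMap M N x) := by
        intro q x
        rw [← Ideal.mem_comap, ← hqq', Ideal.mem_comap]
        constructor
        · intro hx
          exact ⟨⟨τ q (algebraMap M N x), (j x).2.map ((τ q).restrictScalars Z : N →ₐ[Z] N)⟩,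
            (hτ q (j x) _ rfl).mp hx, rfl⟩
        · rintro ⟨y, hy, hyx⟩
          exact (hτ q (j x) y hyx).mpr hy
      intro x
      rw [aux, aux, show τ q₁ (algebraMap M N x) = τ q₂ (algebraMap M N x) from
        DFunLike.congr_fun h12 (x : M)]
    refine Subtype.ext (PrimeSpectrum.ext (Ideal.ext fun a => ?_))
    have hW : IsLocalization ((IsUnit.submonoid B).comap (algebraMap B₀ B)) B := by
      refine (isLocalization_iff _ _).mpr ⟨fun s => s.2, fun b => ?_, fun hxy => ⟨1, ?_⟩⟩
      · obtain ⟨s, y, hs, hy⟩ := h b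
        exact ⟨⟨y, s, hs⟩, (mul_comm _ _).trans hy⟩
      · rw [FaithfulSMul.algebraMap_injective B₀ B hxy]
    -- Clearing denominators by a unit of `B` turns an element of the normalization into one
    -- integral over `B₀`, hence over `Z`; membership in a prime is unaffected.
    have : ∃ s : B₀, IsUnit (algebraMap B₀ B s) ∧ IsIntegral B₀ (algebraMap B₀ M s * (a : M)) := by
      obtain ⟨⟨s, hs⟩, hsa⟩ := IsIntegral.exists_multiple_integral_of_isLocalization
        ((IsUnit.submonoid B).comap (algebraMap B₀ B)) (a : M) a.2
      refine ⟨s, hs, ?_⟩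
      rwa [← Algebra.smul_def]
    obtain ⟨s, hs, hsa⟩ := this
    have hsa' : IsIntegral Z (algebraMap B₀ M s * (a : M)) := isIntegral_trans _ hsa
    have hi : i ⟨_, hsa'⟩ = algebraMap B _ (algebraMap B₀ B s) * a :=
      Subtype.ext (congrArg (· * (a : M)) (IsScalarTower.algebraMap_apply B₀ B M s))
    have := h0 ⟨_, hsa'⟩
    have hu : IsUnit (algebraMap B (Normalization B) (algebraMap B₀ B s)) := hs.map _
    rwa [hi, Ideal.unit_mul_mem_iff_mem _ hu, Ideal.unit_mul_mem_iff_mem _ hu] at this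
  have := ENat.card_le_card_of_injective hinj
  rwa [ENat.card_eq_coe_natCard (M →ₐ[L] N)] at this

/-- The fibres of the normalization of a localization of a finitely generated algebra over a field
are bounded. -/
theorem exists_fibresLE_of_finiteType {K B : Type*} [Field K] [CommRing B] [IsDomain B] [Algebra K B]
    (B₀ : Subalgebra K B) [Algebra.FiniteType K B₀]
    (h : ∀ b : B, ∃ s ∈ B₀, IsUnit s ∧ s * b ∈ B₀) :
    ∃ g : ℕ, FibresLE B (Normalization B) g := by
  -- Noether normalization: the polynomial ring serves as the integrally closed base `Z`.
  obtain ⟨n, f, hf, hfin⟩ := exists_finite_inj_algHom_of_fg K B₀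
  let _ : Algebra (MvPolynomial (Fin n) K) B₀ := f.toRingHom.toAlgebra
  let _ : Algebra (MvPolynomial (Fin n) K) B := (B₀.val.toRingHom.comp f.toRingHom).toAlgebra
  have : IsScalarTower (MvPolynomial (Fin n) K) B₀ B := IsScalarTower.of_algebraMap_eq fun _ => rfl
  have : Module.Finite (MvPolynomial (Fin n) K) B₀ := hfin
  have : FaithfulSMul (MvPolynomial (Fin n) K) B :=
    (faithfulSMul_iff_algebraMap_injective _ _).mpr (Subtype.val_injective.comp hf)
  refine exists_fibresLE_of_finite (MvPolynomial (Fin n) K) B₀ B fun b => ?_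
  obtain ⟨s, hs, hu, hsb⟩ := h b
  exact ⟨⟨s, hs⟩, ⟨s * b, hsb⟩, hu, rfl⟩

end Fibres

/-! ### Consequences of existential closedness and saturation -/

section Closedness

-- The automorphism extends to the algebraic closure, making it a difference field extension. A
-- polynomial equation is a difference equation involving only the zeroth transform.
open Polynomial in
theorem IsExistentiallyClosed.isAlgClosed {K : Type u} [Field K] {σ : RingAut K}
    (h : IsExistentiallyClosed σ) : IsAlgClosed K := by
  refine IsAlgClosed.of_exists_root K fun p _ hp => ?_
  let L := AlgebraicClosure K
  let τ : RingAut L := IsAlgClosure.equivOfEquiv L L (σ : K ≃+* K)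
  have hτ : Extends σ τ := fun x => (IsAlgClosure.equivOfEquiv_algebraMap L L (σ : K ≃+* K) x).symm
  let P : MvPolynomial (Fin 1 × ℤ) K := aeval (MvPolynomial.X (0, 0)) p
  have hP : ∀ {F : Type u} [Field F] [Algebra K F] (ρ : RingAut F) (a : Fin 1 → F),
      diffEval K ρ a P = aeval (a 0) p := by
    intro F _ _ ρ a
    rw [← aeval_algHom_apply]
    simp [diffEval]
  obtain ⟨x, hx⟩ := IsAlgClosed.exists_aeval_eq_zero L p hp.degree_pos.ne'
  obtain ⟨a, ha⟩ := h L τ hτ 1 {P} ⟨fun _ => x, by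
    intro f hf
    rw [Finset.mem_singleton.mp hf, hP, hx]⟩
  refine ⟨a 0, ?_⟩
  have := ha P (Finset.mem_singleton_self P)
  rwa [hP, coe_aeval_eq_eval] at this

/-- Every one-variable polynomial function is given by a term of the language of difference rings. -/
theorem exists_term_realize_eq {K : Type u} [Field K] (σ : RingAut K) (k : Subfield K)
    (f : Polynomial k) :
    let _ := diffStructure σ
    ∃ t : diffLanguage.Term ((k : Set K) ⊕ Unit), ∀ x : K,
      t.realize (Sum.elim Subtype.val fun _ => x) = Polynomial.aeval x f := by
  intro _
  have hC : ∀ c : k, ∃ t : diffLanguage.Term ((k : Set K) ⊕ Unit), ∀ x : K,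
      t.realize (Sum.elim Subtype.val fun _ => x) = (c : K) :=
    fun c => ⟨.var (Sum.inl c), fun x => rfl⟩
  have hmul : ∀ p q : Polynomial k,
      (∃ t : diffLanguage.Term ((k : Set K) ⊕ Unit), ∀ x : K,
        t.realize (Sum.elim Subtype.val fun _ => x) = Polynomial.aeval x p) →
      (∃ t : diffLanguage.Term ((k : Set K) ⊕ Unit), ∀ x : K,
        t.realize (Sum.elim Subtype.val fun _ => x) = Polynomial.aeval x q) →
      ∃ t : diffLanguage.Term ((k : Set K) ⊕ Unit), ∀ x : K,
        t.realize (Sum.elim Subtype.val fun _ => x) = Polynomial.aeval x (p * q) := by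
    rintro p q ⟨s, hs⟩ ⟨t, ht⟩
    refine ⟨.func DiffFunc.mul ![s, t], fun x => ?_⟩
    rw [map_mul, ← hs, ← ht]
    rfl
  induction f using Polynomial.induction_on with
  | C c =>
    obtain ⟨t, ht⟩ := hC c
    exact ⟨t, fun x => by rw [ht, Polynomial.aeval_C]; rfl⟩
  | add p q hp hq =>
    obtain ⟨s, hs⟩ := hp
    obtain ⟨t, ht⟩ := hq
    refine ⟨.func DiffFunc.add ![s, t], fun x => ?_⟩
    rw [map_add, ← hs, ← ht]
    rfl
  | monomial n c h =>
    rw [pow_succ, ← mul_assoc]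
    refine hmul _ _ h ⟨.var (Sum.inr ()), fun x => ?_⟩
    rw [Polynomial.aeval_X]
    rfl

/-- A saturated infinite difference field has transcendental elements over small subfields. -/
theorem IsSaturated.exists_transcendental {K : Type u} [Field K] [Infinite K] {σ : RingAut K}
    {κ : Cardinal.{u}} (h : IsSaturated σ κ) (k : Subfield K) (hk : Cardinal.mk k < κ) :
    ∃ x : K, Transcendental k x := by
  classical
  let _ := diffStructure σ
  choose t ht using exists_term_realize_eq σ k
  let φ : Polynomial k → diffLanguage.Formula ((k : Set K) ⊕ Unit) :=
    fun f => ((t f).equal (.func DiffFunc.zero ![])).not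
  have hφ : ∀ f x, (φ f).Realize (Sum.elim Subtype.val fun _ => x) ↔ Polynomial.aeval x f ≠ 0 := by
    intro f x
    rw [FirstOrder.Language.Formula.realize_not, FirstOrder.Language.Formula.realize_equal, ht]
    rfl
  -- The type says that no nonzero polynomial over `k` vanishes at `x`. A finite part of it excludes
  -- only the roots of one nonzero product, and `K` is infinite.
  obtain ⟨x, hx⟩ := h (k : Set K) hk (φ '' {f | f ≠ 0}) (by
    intro s hs
    choose! f hf hfφ using fun ψ (hψ : ψ ∈ s) => hs hψ
    let g : Polynomial K := ∏ ψ ∈ s, (f ψ).map (algebraMap k K)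
    have hg : g ≠ 0 := Finset.prod_ne_zero_iff.mpr fun ψ hψ =>
      (Polynomial.map_ne_zero_iff (algebraMap k K).injective).mpr (hf ψ hψ)
    obtain ⟨x, hx⟩ := Infinite.exists_notMem_finset g.roots.toFinset
    refine ⟨x, fun ψ hψ => ?_⟩
    rw [← hfφ ψ hψ, hφ]
    intro h0
    refine hx (Multiset.mem_toFinset.mpr ((Polynomial.mem_roots hg).mpr ?_))
    rw [Polynomial.IsRoot.def, Polynomial.eval_prod]
    refine Finset.prod_eq_zero hψ ?_
    rwa [Polynomial.eval_map_algebraMap])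
  refine ⟨x, ?_⟩
  rw [transcendental_iff]
  intro f hf
  by_contra hf0
  exact (hφ f x).mp (hx _ ⟨f, hf0, rfl⟩) hf

end Closedness

/-! ### Rational points of small algebras -/

section Points

/-- A small domain over a small field `k` embeds in an algebraically closed extension `K` of `k`
which has transcendental elements over all small subfields. -/
theorem nonempty_algHom_of_cardinalMk_le {k K D : Type u} [Field k] [Field K] [IsAlgClosed K]
    [Algebra k K] [CommRing D] [IsDomain D] [Algebra k D] {κ : Cardinal.{u}}
    (hκ : Cardinal.aleph0 ≤ κ) (hk : Cardinal.mk k ≤ κ) (hD : Cardinal.mk D ≤ κ)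
    (hK : ∀ F : Subfield K, Cardinal.mk F ≤ κ → ∃ x : K, Transcendental F x) :
    Nonempty (D →ₐ[k] K) := by
  obtain ⟨s, hs⟩ := exists_isTranscendenceBasis k D
  obtain ⟨t, ht⟩ := exists_isTranscendenceBasis k K
  have hst : Cardinal.mk s ≤ Cardinal.mk t := by
    -- Otherwise `k(t)` would be a small field over which all of `K` is algebraic.
    by_contra hlt
    have htκ : Cardinal.mk t ≤ κ :=
      (not_le.mp hlt).le.trans ((Cardinal.mk_set_le s).trans hD)
    let F : Subfield K := (IntermediateField.adjoin k t).toSubfield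
    have hF : Cardinal.mk F ≤ κ :=
      (IntermediateField.cardinalMk_adjoin_le k t).trans (max_le (max_le hk htκ) hκ)
    obtain ⟨x, hx⟩ := hK F hF
    have halg := ht.isAlgebraic_field
    rw [Subtype.range_coe] at halg
    exact hx (halg.isAlgebraic x)
  obtain ⟨e⟩ := (Cardinal.le_def s t).mp hst
  have hy : AlgebraicIndependent k fun i : s => (e i : K) := ht.1.comp e e.injective
  have halg := hs.isAlgebraic
  let E := hs.1.aevalEquiv
  let f : Algebra.adjoin k (Set.range (Subtype.val : s → D)) →ₐ[k] K :=
    (MvPolynomial.aeval fun i : s => (e i : K)).comp E.symm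
  have hf : Function.Injective f :=
    (algebraicIndependent_iff_injective_aeval.mp hy).comp E.symm.injective
  let _ : Algebra (Algebra.adjoin k (Set.range (Subtype.val : s → D))) K := f.toRingHom.toAlgebra
  have : IsScalarTower k (Algebra.adjoin k (Set.range (Subtype.val : s → D))) K :=
    IsScalarTower.of_algebraMap_eq fun x => (f.commutes x).symm
  have : Module.IsTorsionFree (Algebra.adjoin k (Set.range (Subtype.val : s → D))) K :=
    Module.isTorsionFree_iff_algebraMap_injective.mpr hf
  let g : D →ₐ[Algebra.adjoin k (Set.range (Subtype.val : s → D))] K := IsAlgClosed.lift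
  exact ⟨g.restrictScalars k⟩

/-- A domain over `K` with a small multiplicative set of generators has a `K`-rational point, for an
algebraically closed field `K` which has transcendental elements over all small subfields. -/
theorem nonempty_algHom_of_span_eq_top {K D : Type u} [Field K] [IsAlgClosed K]
    [CommRing D] [IsDomain D] [Algebra K D] {κ : Cardinal.{u}}
    (hκ : Cardinal.aleph0 ≤ κ)
    (hK : ∀ F : Subfield K, Cardinal.mk F ≤ κ → ∃ x : K, Transcendental F x)
    (V : Submonoid D) (hV : Submodule.span K (V : Set D) = ⊤) (hVκ : Cardinal.mk V ≤ κ) :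
    Nonempty (D →ₐ[K] K) := by
  obtain ⟨b, hbV, hbspan, hbli⟩ := exists_linearIndependent K (V : Set D)
  let B : Module.Basis b K D := Module.Basis.mk hbli (by rw [Subtype.range_coe, hbspan, hV])
  have hB : ∀ j : b, B j = j := fun j => by simp [B]
  have hbκ : Cardinal.mk b ≤ κ := (Cardinal.mk_le_mk_of_subset hbV).trans hVκ
  -- This small field contains the coordinates of all elements of `V` in the basis `b ⊆ V`. Hence
  -- the `k`-span of `b` is already the ring `k[V]`, a small domain, and a `k`-point of it in `K`
  -- extends linearly to `D`.
  let k : Subfield K := Subfield.closure (Set.range fun p : V × b => B.repr p.1 p.2)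
  have hkκ : Cardinal.mk k ≤ κ := by
    refine (Subfield.cardinalMk_closure_le_max _).trans (max_le (Cardinal.mk_range_le.trans ?_) hκ)
    rw [Cardinal.mk_prod, Cardinal.lift_id, Cardinal.lift_id]
    exact (mul_le_mul' hVκ hbκ).trans (Cardinal.mul_eq_self hκ).le
  let D₁ := Algebra.adjoin k (V : Set D)
  have hVb : ∀ v ∈ V, v ∈ Submodule.span k b := by
    intro v hv
    rw [← B.linearCombination_repr v, Finsupp.linearCombination_apply, Finsupp.sum]
    refine Submodule.sum_mem _ fun j _ => ?_
    have hj : B.repr v j ∈ k := Subfield.subset_closure ⟨(⟨v, hv⟩, j), rfl⟩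
    rw [hB]
    exact Submodule.smul_mem (Submodule.span k b) ⟨_, hj⟩ (Submodule.subset_span j.2)
  have hD₁ : Subalgebra.toSubmodule D₁ = Submodule.span k b := by
    rw [Algebra.adjoin_eq_span, Submonoid.closure_eq]
    exact le_antisymm (Submodule.span_le.mpr hVb) (Submodule.span_mono hbV)
  have hD₁κ : Cardinal.mk D₁ ≤ κ :=
    (Algebra.cardinalMk_adjoin_le k (V : Set D)).trans (max_le (max_le hkκ hVκ) hκ)
  obtain ⟨f⟩ := nonempty_algHom_of_cardinalMk_le (k := k) (K := K) (D := D₁) hκ hkκ hD₁κ hK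
  let F : D →ₗ[K] K := B.constr K fun j => f ⟨j, Algebra.subset_adjoin (hbV j.2)⟩
  have hF : ∀ x (hx : x ∈ D₁), F x = f ⟨x, hx⟩ := by
    intro x hx
    have hx' : x ∈ Submodule.span k b := hD₁ ▸ hx
    have hle : Submodule.span k b ≤ Subalgebra.toSubmodule D₁ := hD₁.ge
    induction hx' using Submodule.span_induction with
    | mem x h =>
      have : F x = F (B ⟨x, h⟩) := by rw [hB]
      rw [this, B.constr_basis]
    | zero => rw [map_zero]; exact (map_zero f).symm
    | add x y h1 h2 ih1 ih2 =>
      rw [map_add, ih1 (hle h1), ih2 (hle h2), ← map_add]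
      rfl
    | smul a x h ih =>
      have h1 : F (a • x) = (a : K) • F x := F.map_smul (a : K) x
      rw [h1, ih (hle h)]
      exact (map_smul f a ⟨x, hle h⟩).symm
  have hFV : ∀ x ∈ V, ∀ y ∈ V, F (x * y) = F x * F y := by
    intro x hx y hy
    rw [hF x (Algebra.subset_adjoin hx), hF y (Algebra.subset_adjoin hy),
      hF (x * y) (Algebra.subset_adjoin (mul_mem hx hy)), ← map_mul]
    rfl
  -- Multiplicativity spreads from the spanning set `V` to `D` one factor at a time.
  have hmulV : ∀ x ∈ V, ∀ y, F (x * y) = F x * F y := by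
    intro x hx y
    have : F ∘ₗ LinearMap.mulLeft K x = F x • F :=
      LinearMap.ext_on hV fun y hy => hFV x hx y hy
    exact LinearMap.congr_fun this y
  have hmul : ∀ x y, F (x * y) = F x * F y := by
    intro x y
    have : F ∘ₗ LinearMap.mulRight K y = F y • F :=
      LinearMap.ext_on hV fun x hx => (hmulV x hx y).trans (mul_comm _ _)
    exact (LinearMap.congr_fun this x).trans (mul_comm _ _)
  refine ⟨AlgHom.ofLinearMap F ?_ hmul⟩
  rw [hF 1 (one_mem _)]
  exact map_one f

end Points

/-! ### (ALG1) makes all transforms algebraic -/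

section Algebraicity

variable {k Ω : Type u} [Field k] [Field Ω] [Algebra k Ω]

theorem Extends.symm {ρ : RingAut k} {τ : RingAut Ω} (h : Extends ρ τ) : Extends ρ⁻¹ τ⁻¹ := by
  intro x
  apply τ.injective
  rw [← h]
  change algebraMap k Ω ((ρ * ρ⁻¹) x) = (τ * τ⁻¹) (algebraMap k Ω x)
  rw [mul_inv_cancel, mul_inv_cancel]
  rfl

theorem mem_matroid_closure_iff {X : Set Ω} {x : Ω} :
    x ∈ (AlgebraicIndependent.matroid k Ω).closure X ↔
      IsAlgebraic (IntermediateField.adjoin k X) x := by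
  rw [AlgebraicIndependent.matroid_closure_eq, SetLike.mem_coe, Subalgebra.mem_algebraicClosure,
    IntermediateField.isAlgebraic_adjoin_iff]

/-- `τ` need not fix `k` pointwise, but it acts on it through `ρ`; so it maps `k(X)` into `k(τ X)`
and preserves algebraic dependence. -/
theorem mem_matroid_closure_image {ρ : RingAut k} {τ : RingAut Ω} (h : Extends ρ τ) {X : Set Ω}
    {x : Ω} (hx : x ∈ (AlgebraicIndependent.matroid k Ω).closure X) :
    τ x ∈ (AlgebraicIndependent.matroid k Ω).closure (τ '' X) := by
  rw [mem_matroid_closure_iff] at hx ⊢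
  have hmem : ∀ y : IntermediateField.adjoin k X, τ y ∈ IntermediateField.adjoin k (τ '' X) := by
    rintro ⟨y, hy⟩
    induction hy using IntermediateField.adjoin_induction with
    | mem y hy => exact IntermediateField.subset_adjoin _ _ ⟨y, hy, rfl⟩
    | algebraMap c =>
      change τ (algebraMap k Ω c) ∈ _
      rw [← h c]
      exact IntermediateField.algebraMap_mem _ _
    | add y z _ _ hy hz => exact (map_add τ y z) ▸ add_mem hy hz
    | inv y _ hy => exact (map_inv₀ τ y) ▸ inv_mem hy
    | mul y z _ _ hy hz => exact (map_mul τ y z) ▸ mul_mem hy hz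
  let f : IntermediateField.adjoin k X →+* IntermediateField.adjoin k (τ '' X) :=
    ((τ : Ω →+* Ω).comp (algebraMap (IntermediateField.adjoin k X) Ω)).codRestrict
      (IntermediateField.adjoin k (τ '' X)) hmem
  exact hx.ringHom_of_comp_eq f (τ : Ω →+* Ω) f.injective rfl

theorem algebraicIndependent_image {ρ : RingAut k} {τ : RingAut Ω} (h : Extends ρ τ) {X : Set Ω}
    (hX : (AlgebraicIndependent.matroid k Ω).Indep X) :
    (AlgebraicIndependent.matroid k Ω).Indep (τ '' X) := by
  rw [AlgebraicIndependent.matroid_indep_iff] at hX ⊢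
  have := hX.ringHom_of_comp_eq (ρ : k →+* k) (τ : Ω →+* Ω) ρ.surjective τ.injective
    (RingHom.ext h)
  have hr : Set.range ((τ : Ω →+* Ω) ∘ fun x : X => (x : Ω)) = τ '' X := by
    rw [Set.range_comp, Subtype.range_coe]
    rfl
  exact hr ▸ this.to_subtype_range

/-- A finite set, whose image under an automorphism is algebraic over it, is algebraic over its
image. -/
theorem subset_matroid_closure_image {ρ : RingAut k} {τ : RingAut Ω} (h : Extends ρ τ) {T : Set Ω}
    (hT : T.Finite) (hTτ : τ '' T ⊆ (AlgebraicIndependent.matroid k Ω).closure T) :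
    T ⊆ (AlgebraicIndependent.matroid k Ω).closure (τ '' T) := by
  obtain ⟨B, hB⟩ := (AlgebraicIndependent.matroid k Ω).exists_isBasis T (Set.subset_univ T)
  have hBind := algebraicIndependent_image h hB.indep
  have hBτ : τ '' B ⊆ τ '' T := Set.image_mono hB.subset
  have hbasis : (AlgebraicIndependent.matroid k Ω).IsBasis (τ '' B)
      ((AlgebraicIndependent.matroid k Ω).closure T) := by
    -- The image of `B` is independent, of the same finite cardinality as `B`, and lies in a closure
    -- of that rank.
    refine hBind.isBasis_of_eRk_ge ((hT.subset hB.subset).image τ) (hBτ.trans hTτ) ?_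
    rw [Matroid.eRk_closure_eq, ← hB.encard_eq_eRk, hBind.eRk_eq_encard, τ.injective.encard_image]
  exact ((AlgebraicIndependent.matroid k Ω).subset_closure T (Set.subset_univ T)).trans
    (hbasis.subset_closure.trans (Matroid.closure_mono _ hBτ))

/-- (ALG1) only controls positive transforms. Equality of finite transcendence degrees makes `a`
algebraic over `σ(a)`, and applying `σ⁻¹` gives the negative ones. -/
theorem SatisfiesALG.isAlgebraic {ρ : RingAut k} {σ : RingAut Ω} (h : Extends ρ σ) {n : ℕ}
    {a : Fin n → Ω} (ha : SatisfiesALG k σ 1 a) (x : genσ k σ a) : IsAlgebraic (gen k a) (x : Ω) := by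
  let cl := (AlgebraicIndependent.matroid k Ω).closure
  have hsub : Set.range a ⊆ cl (Set.range a) := Matroid.subset_closure _ _ (Set.subset_univ _)
  have h1 : σ '' Set.range a ⊆ cl (Set.range a) := by
    rintro _ ⟨_, ⟨j, rfl⟩, rfl⟩
    exact mem_matroid_closure_iff.mpr (by simpa using ha a rfl j)
  have h2 : (σ⁻¹ : RingAut Ω) '' Set.range a ⊆ cl (Set.range a) := by
    rintro _ ⟨_, ⟨j, rfl⟩, rfl⟩
    have := mem_matroid_closure_image h.symm
      (subset_matroid_closure_image h (Set.finite_range a) h1 ⟨j, rfl⟩)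
    rwa [← Set.image_comp, show ((σ⁻¹ : RingAut Ω) ∘ σ : Ω → Ω) = id from
      funext fun x => σ.symm_apply_apply x, Set.image_id] at this
  have step : ∀ {ρ' : RingAut k} {τ : RingAut Ω}, Extends ρ' τ →
      τ '' Set.range a ⊆ cl (Set.range a) → ∀ x ∈ cl (Set.range a), τ x ∈ cl (Set.range a) := by
    intro ρ' τ hτ ha x hx
    exact Matroid.closure_subset_closure_of_subset_closure ha (mem_matroid_closure_image hτ hx)
  have hpow : ∀ (i : ℤ) (j : Fin n), (σ ^ i) (a j) ∈ cl (Set.range a) := by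
    intro i j
    induction i using Int.induction_on with
    | zero => exact hsub ⟨j, rfl⟩
    | succ i ih => rw [add_comm, zpow_add, zpow_one]; exact step h h1 _ ih
    | pred i ih =>
      rw [sub_eq_add_neg, add_comm, zpow_add, zpow_neg_one]; exact step h.symm h2 _ ih
  refine mem_matroid_closure_iff.mp (?_ : (x : Ω) ∈ cl (Set.range a))
  obtain ⟨x, hx⟩ := x
  have hle : cl (Set.range fun p : Fin n × ℤ => (σ ^ p.2) (a p.1)) ⊆ cl (Set.range a) := by
    refine Matroid.closure_subset_closure_of_subset_closure ?_
    rintro _ ⟨⟨j, i⟩, rfl⟩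
    exact hpow i j
  exact hle (mem_matroid_closure_iff.mpr (isAlgebraic_algebraMap (⟨x, hx⟩ : genσ k σ a)))

end Algebraicity

/-! ### The bound by a fibre of the normalization -/

section Bound

/-- For a ring `S` integral over `R` and generated by elements integral over subfields of `R`, the
number of primes of `S` over `P` and below a `K`-rational point is bounded by the cardinality of
the fibres of the normalization of `R ⧸ P`. -/
theorem encard_primesOverBelow_le {R S K : Type*} [CommRing R] [CommRing S] [Algebra R S]
    [Field K] [IsAlgClosed K] [Algebra.IsIntegral R S]
    [Algebra K R] [Algebra K S] [IsScalarTower K R S] {G : Set S} (hG : Algebra.adjoin R G = ⊤)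
    (hGF : ∀ s ∈ G, ∃ (F : Type u) (_ : Field F) (f : F →+* R),
      ((algebraMap R S).comp f).IsIntegralElem s)
    (π : S →ₐ[K] K) (Q : Ideal S) (hQ : Q ≤ RingHom.ker π) (P : Ideal R) [P.IsPrime]
    (hPQ : P ≤ Q.comap (algebraMap R S)) {g : ℕ} (hg : FibresLE (R ⧸ P) (Normalization (R ⧸ P)) g) :
    (primesOverBelow (algebraMap R S) P Q).encard ≤ g := by
  let M := FractionRing (R ⧸ P)
  have hker : RingHom.ker (algebraMap R M) = P := by
    rw [IsScalarTower.algebraMap_eq R (R ⧸ P) M, RingHom.ker_comp_of_injective _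
      (IsFractionRing.injective (R ⧸ P) M)]
    exact Ideal.mk_ker
  obtain ⟨α, hα, hαp⟩ := exists_injOn_primes_integralClosure (M := M) hG hGF π Q hQ
  have : Algebra.IsIntegral R (R ⧸ P) :=
    Algebra.IsIntegral.of_surjective (IsScalarTower.toAlgHom R R (R ⧸ P)) Ideal.Quotient.mk_surjective
  let h : Normalization (R ⧸ P) →+* integralClosure R M :=
    (integralClosure (R ⧸ P) M).val.toRingHom.codRestrict (integralClosure R M)
      fun x => isIntegral_trans _ x.2
  have hh : Function.Surjective h := fun x => ⟨⟨x, x.2.tower_top⟩, rfl⟩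
  let π₀ : R ⧸ P →+* K := Ideal.Quotient.lift P ((π : S →+* K).comp (algebraMap R S))
    fun r hr => hQ (hPQ hr)
  -- The fibre used is the one over the trace of `π`, which may be larger than the trace of `Q`.
  let p : PrimeSpectrum (R ⧸ P) := ⟨RingHom.ker π₀, RingHom.ker_isPrime π₀⟩
  let β : primesOverBelow (algebraMap R S) P Q → {q : PrimeSpectrum (Normalization (R ⧸ P)) |
      PrimeSpectrum.comap (algebraMap (R ⧸ P) (Normalization (R ⧸ P))) q = p} := fun P' =>
    ⟨PrimeSpectrum.comap h (α ⟨P'.1, P'.2.1, P'.2.2.1.trans hker.symm, P'.2.2.2⟩), by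
      refine PrimeSpectrum.ext (Ideal.ext fun b => ?_)
      obtain ⟨r, rfl⟩ := Ideal.Quotient.mk_surjective b
      exact SetLike.ext_iff.mp (hαp ⟨P'.1, P'.2.1, P'.2.2.1.trans hker.symm, P'.2.2.2⟩) r⟩
  have hβ : Function.Injective β := by
    intro P₁ P₂ h12
    have := hα (PrimeSpectrum.comap_injective_of_surjective h hh (congrArg Subtype.val h12))
    exact Subtype.ext (congrArg (fun x => x.1) this)
  exact (ENat.card_le_card_of_injective hβ).trans (hg p)

end Bound

/-! ### Generators of the coordinate rings -/

section CoordinateRings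

variable {k K Ω : Type u} [Field k] [Field K] [Field Ω] [Algebra k K] [Algebra k Ω]

/-- Pure tensors span, and each is the product of its factors placed in single slots. -/
theorem PiTensor_adjoin_eq_top {N : ℕ} (A : Fin N → Type u) [∀ i, CommRing (A i)]
    [∀ i, Algebra K (A i)] (s : ∀ i, Set (A i)) (hs : ∀ i, Algebra.adjoin K (s i) = ⊤) :
    Algebra.adjoin K (⋃ i, PiTensorProduct.singleAlgHom (R := K) i '' s i) =
      (⊤ : Subalgebra K (AlgTensor K A)) := by
  rw [← Algebra.toSubmodule_eq_top, eq_top_iff, ← PiTensorProduct.span_tprod_eq_top,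
    Submodule.span_le]
  rintro _ ⟨x, rfl⟩
  have hx : PiTensorProduct.tprod K x = ∏ i, PiTensorProduct.singleAlgHom (R := K) i (x i) := by
    rw [← Finset.univ_prod_mulSingle x, PiTensorProduct.tprod_prod]
    simp
  rw [hx]
  refine Subalgebra.prod_mem _ fun i _ => ?_
  have : Algebra.adjoin K (PiTensorProduct.singleAlgHom (R := K) i '' s i) ≤
      Algebra.adjoin K (⋃ i, PiTensorProduct.singleAlgHom (R := K) i '' s i) :=
    Algebra.adjoin_mono (Set.subset_iUnion_of_subset i subset_rfl)
  refine this ?_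
  rw [← AlgHom.map_adjoin, hs]
  exact Subalgebra.mem_map.mpr ⟨x i, Algebra.mem_top, rfl⟩

theorem adjoin_range_includeRight (F : Type u) [CommRing F] [Algebra k F] :
    Algebra.adjoin K (Set.range (Algebra.TensorProduct.includeRight : F →ₐ[k] K ⊗[k] F)) = ⊤ := by
  rw [eq_top_iff]
  rintro x -
  induction x using TensorProduct.induction_on with
  | zero => exact zero_mem _
  | add x y hx hy => exact add_mem hx hy
  | tmul c l =>
    have : c ⊗ₜ[k] l = c • (Algebra.TensorProduct.includeRight l : K ⊗[k] F) := by
      simp [TensorProduct.smul_tmul']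
    rw [this]
    exact Subalgebra.smul_mem _ (Algebra.subset_adjoin (Set.mem_range_self l)) c

/-- The coordinate functions in a tensor product of algebras `K ⊗ F i`. -/
noncomputable def coordHom (k K : Type u) [Field k] [Field K] [Algebra k K] {N : ℕ}
    (F : Fin N → Type u) [∀ i, CommRing (F i)] [∀ i, Algebra k (F i)] (i : Fin N) :
    F i →+* AlgTensor K fun i => K ⊗[k] F i :=
  (PiTensorProduct.singleAlgHom (R := K) (A := fun i => K ⊗[k] F i) i).toRingHom.comp
    (Algebra.TensorProduct.includeRight : F i →ₐ[k] K ⊗[k] F i).toRingHom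

theorem adjoin_range_coordHom {N : ℕ} (F : Fin N → Type u) [∀ i, CommRing (F i)]
    [∀ i, Algebra k (F i)] : Algebra.adjoin K (⋃ i, Set.range (coordHom k K F i)) = ⊤ := by
  rw [← PiTensor_adjoin_eq_top (K := K) (fun i => K ⊗[k] F i)
    (fun i => Set.range (Algebra.TensorProduct.includeRight : F i →ₐ[k] K ⊗[k] F i))
    fun i => adjoin_range_includeRight (F i)]
  congr 1
  refine Set.iUnion_congr fun i => ?_
  rw [← Set.range_comp]
  rfl

theorem coordHom_algebraMap {N : ℕ} (F : Fin N → Type u) [∀ i, CommRing (F i)]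
    [∀ i, Algebra k (F i)] (i : Fin N) (c : k) :
    coordHom k K F i (algebraMap k (F i) c) = algebraMap K _ (algebraMap k K c) := by
  have : (Algebra.TensorProduct.includeRight (algebraMap k (F i) c) : K ⊗[k] F i) =
      algebraMap K _ (algebraMap k K c) := by
    rw [AlgHom.commutes, ← IsScalarTower.algebraMap_apply]
  change PiTensorProduct.singleAlgHom (R := K) (A := fun i => K ⊗[k] F i) i
    (Algebra.TensorProduct.includeRight (algebraMap k (F i) c)) = _
  rw [this, AlgHom.commutes]

variable {N : ℕ} {d : Fin N → ℕ} (σ : RingAut Ω) (a : ∀ i, Fin (d i) → Ω)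

theorem coordRingIncl_coordHom (i : Fin N) (l : gen k (a i)) :
    coordRingIncl k K σ a (coordHom k K (fun i => gen k (a i)) i l) =
      coordHom k K (fun i => genσ k σ (a i)) i
        (IntermediateField.inclusion (gen_le_genσ k σ (a i)) l) := by
  have h : ∀ x : ∀ i, Coord k K (a i), coordRingIncl k K σ a (PiTensorProduct.tprod K x) =
      PiTensorProduct.tprod K fun i => coordIncl k K σ (a i) (x i) :=
    fun x => PiTensorProduct.lift.tprod x
  refine (h _).trans (congrArg (PiTensorProduct.tprod K) (funext fun j => ?_))
  let x : Coord k K (a i) := 1 ⊗ₜ l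
  let y : Coordσ k K σ (a i) := 1 ⊗ₜ IntermediateField.inclusion (gen_le_genσ k σ (a i)) l
  change coordIncl k K σ (a j) (Pi.mulSingle (M := fun i => Coord k K (a i)) i x j) =
    Pi.mulSingle (M := fun i => Coordσ k K σ (a i)) i y j
  rcases eq_or_ne j i with rfl | hji
  · rw [Pi.mulSingle_eq_same, Pi.mulSingle_eq_same]
    rw [coordIncl, Algebra.TensorProduct.map_tmul, map_one]
  · rw [Pi.mulSingle_eq_of_ne hji, Pi.mulSingle_eq_of_ne hji]
    exact map_one (coordIncl k K σ (a j)).toRingHom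

end CoordinateRings

/-! ### Finiteness and rational points for the coordinate rings -/

section CoordinateRings

variable {k K Ω : Type u} [Field k] [Field K] [Field Ω] [Algebra k K] [Algebra k Ω]
  {N : ℕ} {d : Fin N → ℕ}

/-- The coordinate ring of a finite family of tuples is a localization of the algebra generated by
the coordinates. -/
theorem exists_isUnit_mul_mem_adjoin (a : ∀ i, Fin (d i) → Ω) (r : CoordRing k K a) :
    ∃ s ∈ Algebra.adjoin K (Set.range fun p : Σ i, Fin (d i) =>
      coordHom k K (fun i => gen k (a i)) p.1
        ⟨a p.1 p.2, IntermediateField.subset_adjoin _ _ (Set.mem_range_self p.2)⟩),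
      IsUnit s ∧ s * r ∈ Algebra.adjoin K (Set.range fun p : Σ i, Fin (d i) =>
        coordHom k K (fun i => gen k (a i)) p.1
          ⟨a p.1 p.2, IntermediateField.subset_adjoin _ _ (Set.mem_range_self p.2)⟩) := by
  set B₀ := Algebra.adjoin K (Set.range fun p : Σ i, Fin (d i) =>
    coordHom k K (fun i => gen k (a i)) p.1
      ⟨a p.1 p.2, IntermediateField.subset_adjoin _ _ (Set.mem_range_self p.2)⟩)
  have hpoly : ∀ i, ∀ l : gen k (a i), (l : Ω) ∈ Algebra.adjoin k (Set.range (a i)) →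
      coordHom k K (fun i => gen k (a i)) i l ∈ B₀ := by
    rintro i ⟨l, hl'⟩ hl
    have hle : Algebra.adjoin k (Set.range (a i)) ≤ (gen k (a i)).toSubalgebra :=
      IntermediateField.algebra_adjoin_le_adjoin k _
    change l ∈ _ at hl
    induction hl using Algebra.adjoin_induction with
    | mem l hl =>
      obtain ⟨j, rfl⟩ := hl
      exact Algebra.subset_adjoin ⟨⟨i, j⟩, rfl⟩
    | algebraMap c =>
      have := coordHom_algebraMap (k := k) (K := K) (fun i => gen k (a i)) i c
      exact this ▸ B₀.algebraMap_mem _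
    | add x y hx hy ihx ihy =>
      have := map_add (coordHom k K (fun i => gen k (a i)) i) ⟨x, hle hx⟩ ⟨y, hle hy⟩
      exact this ▸ add_mem (ihx _) (ihy _)
    | mul x y hx hy ihx ihy =>
      have := map_mul (coordHom k K (fun i => gen k (a i)) i) ⟨x, hle hx⟩ ⟨y, hle hy⟩
      exact this ▸ mul_mem (ihx _) (ihy _)
  have hr : r ∈ Algebra.adjoin K (⋃ i, Set.range (coordHom k K (fun i => gen k (a i)) i)) := by
    rw [adjoin_range_coordHom]
    exact Algebra.mem_top
  induction hr using Algebra.adjoin_induction with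
  | mem r hr =>
    obtain ⟨i, l, rfl⟩ := Set.mem_iUnion.mp hr
    obtain ⟨x, hx, y, hy, hxy⟩ := IntermediateField.mem_adjoin_iff_div.mp l.2
    -- A zero denominator is possible here; the quotient is then `0` by convention.
    rcases eq_or_ne y 0 with rfl | hy0
    · refine ⟨1, one_mem _, isUnit_one, ?_⟩
      rw [one_mul]
      exact hpoly i l (by rw [hxy, div_zero]; exact zero_mem _)
    · have hle := IntermediateField.algebra_adjoin_le_adjoin k (Set.range (a i))
      let y' : gen k (a i) := ⟨y, hle hy⟩
      have hy' : y' ≠ 0 := fun h => hy0 (congrArg Subtype.val h)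
      -- The denominator is nonzero in the field `k(a i)`, so its image is a unit.
      refine ⟨coordHom k K (fun i => gen k (a i)) i y', hpoly i y' hy,
        (IsUnit.mk0 y' hy').map _, ?_⟩
      rw [← map_mul]
      refine hpoly i (y' * l) ?_
      have : ((y' * l : gen k (a i)) : Ω) = x := by
        change y * (l : Ω) = x
        rw [hxy, mul_div_cancel₀ _ hy0]
      rwa [this]
  | algebraMap c => exact ⟨1, one_mem _, isUnit_one, by rw [one_mul]; exact B₀.algebraMap_mem c⟩
  | add x y _ _ hx hy =>
    obtain ⟨s, hs, hsu, hsx⟩ := hx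
    obtain ⟨t, ht, htu, hty⟩ := hy
    refine ⟨s * t, mul_mem hs ht, hsu.mul htu, ?_⟩
    rw [show s * t * (x + y) = t * (s * x) + s * (t * y) by ring]
    exact add_mem (mul_mem ht hsx) (mul_mem hs hty)
  | mul x y _ _ hx hy =>
    obtain ⟨s, hs, hsu, hsx⟩ := hx
    obtain ⟨t, ht, htu, hty⟩ := hy
    refine ⟨s * t, mul_mem hs ht, hsu.mul htu, ?_⟩
    rw [mul_mul_mul_comm]
    exact mul_mem hsx hty

/-- Being a localization of a finitely generated `K`-algebra passes to the quotient by `P`. -/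
theorem exists_fibresLE_coordRing (a : ∀ i, Fin (d i) → Ω) (P : Ideal (CoordRing k K a))
    [P.IsPrime] :
    ∃ g : ℕ, FibresLE (CoordRing k K a ⧸ P) (Normalization (CoordRing k K a ⧸ P)) g := by
  let B₀ := Algebra.adjoin K (Set.range fun p : Σ i, Fin (d i) =>
    coordHom k K (fun i => gen k (a i)) p.1
      ⟨a p.1 p.2, IntermediateField.subset_adjoin _ _ (Set.mem_range_self p.2)⟩)
  have hfg : (B₀.map (Ideal.Quotient.mkₐ K P)).FG :=
    (Subalgebra.fg_def.mpr ⟨_, Set.finite_range _, rfl⟩).map _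
  have : Algebra.FiniteType K (B₀.map (Ideal.Quotient.mkₐ K P)) :=
    (Subalgebra.fg_iff_finiteType _).mp hfg
  refine exists_fibresLE_of_finiteType (B₀.map (Ideal.Quotient.mkₐ K P)) fun b => ?_
  obtain ⟨r, rfl⟩ := Ideal.Quotient.mk_surjective b
  obtain ⟨s, hs, hu, hsr⟩ := exists_isUnit_mul_mem_adjoin a r
  exact ⟨Ideal.Quotient.mk P s, ⟨s, hs, rfl⟩, hu.map _, ⟨s * r, hsr, map_mul _ _ _⟩⟩

theorem cardinalMk_genσ_le [Infinite k] (σ : RingAut Ω) {n : ℕ} (a : Fin n → Ω) :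
    Cardinal.mk (genσ k σ a) ≤ Cardinal.mk k := by
  refine (IntermediateField.cardinalMk_adjoin_le k _).trans
    (max_le (max_le le_rfl ?_) (Cardinal.aleph0_le_mk k))
  exact (Set.countable_range _).le_aleph0.trans (Cardinal.aleph0_le_mk k)

/-- A proper quotient of the ring `R_σ` by a prime ideal has a `K`-rational point. -/
theorem exists_algHom_coordRingσ [Infinite k] [IsAlgClosed K]
    (hK : ∀ F : Subfield K, Cardinal.mk F ≤ Cardinal.mk k → ∃ x : K, Transcendental F x)
    (σ : RingAut Ω) (a : ∀ i, Fin (d i) → Ω) (Q : Ideal (CoordRingσ k K σ a)) [Q.IsPrime] :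
    ∃ π : CoordRingσ k K σ a →ₐ[K] K, Q ≤ RingHom.ker π := by
  have hκ : Cardinal.aleph0 ≤ Cardinal.mk k := Cardinal.aleph0_le_mk k
  let G : Set (CoordRingσ k K σ a) := ⋃ i, Set.range (coordHom k K (fun i => genσ k σ (a i)) i)
  have hG : Algebra.adjoin K G = ⊤ := adjoin_range_coordHom _
  have hGκ : Cardinal.mk G ≤ Cardinal.mk k := by
    have h1 := Cardinal.mk_iUnion_le_lift fun i =>
      Set.range (coordHom k K (fun i => genσ k σ (a i)) i)
    simp only [Cardinal.lift_uzero] at h1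
    refine h1.trans ((mul_le_mul' (b := Cardinal.mk k) (d := Cardinal.mk k) ?_ ?_).trans
      (Cardinal.mul_eq_self hκ).le)
    · exact (Cardinal.lift_le_aleph0.mpr Cardinal.mk_le_aleph0).trans hκ
    · exact ciSup_le' fun i => Cardinal.mk_range_le.trans (cardinalMk_genσ_le σ (a i))
  have hcl : Cardinal.mk (Submonoid.closure G) ≤ Cardinal.mk k := by
    -- The monoid generated by `G` is no larger than the ring generated by `G`, whose cardinality is
    -- bounded by that of `k`.
    have h1 : Submonoid.closure G ≤ (Algebra.adjoin ℤ G).toSubmonoid :=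
      Submonoid.closure_le.mpr Algebra.subset_adjoin
    have h2 := Algebra.lift_cardinalMk_adjoin_le ℤ G
    simp only [Cardinal.lift_uzero, Cardinal.mk_int, Cardinal.lift_aleph0] at h2
    exact (Cardinal.mk_le_mk_of_subset h1).trans (h2.trans (max_le (max_le hκ hGκ) hκ))
  let V := (Submonoid.closure G).map (Ideal.Quotient.mk Q)
  have hV : Submodule.span K (V : Set (CoordRingσ k K σ a ⧸ Q)) = ⊤ := by
    have h1 : Submodule.span K (Submonoid.closure G : Set (CoordRingσ k K σ a)) = ⊤ := by
      rw [← Algebra.adjoin_eq_span, hG, Algebra.top_toSubmodule]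
    have h2 := Submodule.map_span (Ideal.Quotient.mkₐ K Q).toLinearMap
      (Submonoid.closure G : Set (CoordRingσ k K σ a))
    rw [h1, Submodule.map_top, LinearMap.range_eq_top.mpr (Ideal.Quotient.mkₐ_surjective K Q)] at h2
    exact h2.symm
  have hVκ : Cardinal.mk V ≤ Cardinal.mk k := Cardinal.mk_image_le.trans hcl
  obtain ⟨f⟩ := nonempty_algHom_of_span_eq_top hκ hK V hV hVκ
  refine ⟨f.comp (Ideal.Quotient.mkₐ K Q), fun x hx => ?_⟩
  rw [RingHom.mem_ker, AlgHom.comp_apply, Ideal.Quotient.mkₐ_eq_mk,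
    Ideal.Quotient.eq_zero_iff_mem.mpr hx, map_zero]

end CoordinateRings
end VirtualDifference

open VirtualDifference in
theorem proposition2p17
    -- the difference fields `k₀ ⊆ K ⊆ Ω`
    {k₀ K Ω : Type u} [Field k₀] [Field K] [Field Ω]
    [Algebra k₀ K] [Algebra K Ω] [Algebra k₀ Ω] [IsScalarTower k₀ K Ω]
    (σ₀ : RingAut k₀) (σK : RingAut K) (σ : RingAut Ω)
    (h₀ : Extends σ₀ σK) (hK : Extends σK σ)
    [IsAlgClosed k₀]
    (hKec : IsExistentiallyClosed σK) (hKsat : IsSaturated σK (Order.succ (Cardinal.mk k₀)))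
    (hΩec : IsExistentiallyClosed σ) (hΩsat : IsSaturated σ (Order.succ (Cardinal.mk K)))
    -- semi-basic types satisfying (ALG1), given by realisations
    {N : ℕ} {d : Fin N → ℕ} (a : ∀ i, Fin (d i) → Ω)
    (hsb : ∀ i, IsSemiBasic k₀ (Cardinal.mk K) σ (a i))
    (halg : ∀ i, SatisfiesALG k₀ σ 1 (a i))
    -- the prime ideals
    (Q : Ideal (CoordRingσ k₀ K σ a)) (hQ : Q.IsPrime)
    (P : Ideal (CoordRing k₀ K a)) (hP : P.IsPrime)
    (hPQ : P ≤ Q.comap (coordRingIncl k₀ K σ a)) :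
    (primesOverBelow (coordRingIncl k₀ K σ a).toRingHom P Q).Finite ∧
    (∃ g : ℕ, FibresLE (CoordRing k₀ K a ⧸ P) (Normalization (CoordRing k₀ K a ⧸ P)) g) ∧
    ∀ g : ℕ, FibresLE (CoordRing k₀ K a ⧸ P) (Normalization (CoordRing k₀ K a ⧸ P)) g →
      (primesOverBelow (coordRingIncl k₀ K σ a).toRingHom P Q).ncard ≤ g := by
  have hKalg : IsAlgClosed K := hKec.isAlgClosed
  have hext : Extends σ₀ σ := fun x => by
    rw [IsScalarTower.algebraMap_apply k₀ K Ω, h₀, hK, ← IsScalarTower.algebraMap_apply]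
  -- Saturation for the successor of `|k₀|` covers exactly the subfields of cardinality at most
  -- `|k₀|`.
  obtain ⟨π, hπ⟩ := exists_algHom_coordRingσ
    (fun F hF => hKsat.exists_transcendental F (Order.lt_succ_of_le hF)) σ a Q
  let _ : Algebra (CoordRing k₀ K a) (CoordRingσ k₀ K σ a) :=
    (coordRingIncl k₀ K σ a).toRingHom.toAlgebra
  have : IsScalarTower K (CoordRing k₀ K a) (CoordRingσ k₀ K σ a) :=
    IsScalarTower.of_algebraMap_eq fun x => ((coordRingIncl k₀ K σ a).commutes x).symm
  let G : Set (CoordRingσ k₀ K σ a) :=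
    ⋃ i, Set.range (coordHom k₀ K (fun i => genσ k₀ σ (a i)) i)
  have hG : Algebra.adjoin (CoordRing k₀ K a) G = ⊤ := by
    have h1 : Algebra.adjoin K G = ⊤ := adjoin_range_coordHom _
    have h2 : Algebra.adjoin K G ≤ (Algebra.adjoin (CoordRing k₀ K a) G).restrictScalars K :=
      Algebra.adjoin_le Algebra.subset_adjoin
    rw [h1] at h2
    exact eq_top_iff.mpr fun x _ => h2 Algebra.mem_top
  have hGF : ∀ s ∈ G, ∃ (F : Type u) (_ : Field F) (f : F →+* CoordRing k₀ K a),
      ((algebraMap (CoordRing k₀ K a) (CoordRingσ k₀ K σ a)).comp f).IsIntegralElem s := by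
    intro s hs
    obtain ⟨i, l, rfl⟩ := Set.mem_iUnion.mp hs
    -- The subfield of `R` over which the generators from `k₀(x_i)_σ` are integral is the copy of
    -- `k₀(x_i)`.
    refine ⟨gen k₀ (a i), inferInstance, coordHom k₀ K (fun i => gen k₀ (a i)) i, ?_⟩
    have hl : (IntermediateField.inclusion (gen_le_genσ k₀ σ (a i))).toRingHom.IsIntegralElem l := by
      obtain ⟨p, hp, hpl⟩ := ((halg i).isAlgebraic hext l).isIntegral
      refine ⟨p, hp, Subtype.ext ?_⟩
      refine Eq.trans ?_ hpl
      exact Polynomial.hom_eval₂ p _ (algebraMap (genσ k₀ σ (a i)) Ω) l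
    have h1 := hl.map (coordHom k₀ K (fun i => genσ k₀ σ (a i)) i)
    have h2 : (algebraMap (CoordRing k₀ K a) (CoordRingσ k₀ K σ a)).comp
        (coordHom k₀ K (fun i => gen k₀ (a i)) i) =
        (coordHom k₀ K (fun i => genσ k₀ σ (a i)) i).comp
          (IntermediateField.inclusion (gen_le_genσ k₀ σ (a i))).toRingHom :=
      RingHom.ext fun x => coordRingIncl_coordHom σ a i x
    rwa [h2]
  have hint : Algebra.IsIntegral (CoordRing k₀ K a) (CoordRingσ k₀ K σ a) := by
    rw [← integralClosure_eq_top_iff, eq_top_iff, ← hG]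
    refine Algebra.adjoin_le fun s hs => ?_
    obtain ⟨F, _, f, p, hp, hps⟩ := hGF s hs
    exact ⟨p.map f, hp.map f, by rw [Polynomial.eval₂_map]; exact hps⟩
  have hbound : ∀ g : ℕ,
      FibresLE (CoordRing k₀ K a ⧸ P) (Normalization (CoordRing k₀ K a ⧸ P)) g →
      (primesOverBelow (coordRingIncl k₀ K σ a).toRingHom P Q).encard ≤ g := fun g hg =>
    encard_primesOverBelow_le hG hGF π Q hπ P hPQ hg
  obtain ⟨g, hg⟩ := exists_fibresLE_coordRing a P
  have hfin := Set.finite_of_encard_le_coe (hbound g hg)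
  refine ⟨hfin, ⟨g, hg⟩, fun g hg => ?_⟩
  have := hbound g hg
  rwa [← hfin.cast_ncard_eq, Nat.cast_le] at this
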